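/- Consider the general barrier coverage problem on a line segment. An instance consists of a barrier $B=[0,L]$ with $L>0$ and $n$ sensors on the real line; sensor $i$ is initially located at $x_i$, where $x_1\le x_2\le\cdots\le x_n$, and has an arbitrary range $r_i>0$, and $2\sum_{i=1}^n r_i\ge L$. A sensor with range $r$ at position $y$ covers the interval $[y-r,y+r]$. The task is to compute destinations $y_1,\ldots,y_n\in\mathbb{R}$ such that every point of $B$ is covered by at least one sensor when each sensor $i$ is moved to $y_i$, and such that the maximum moving distance $\max_{1\le i\le n}|x_i-y_i|$ is smallest possible among all destinations with this property. Theorem 3 (general BCLS optimization). This problem is solvable in polynomial time, namely in $O(n^2\log n)$ time: there is a single real-RAM program that, for every $n$ and every instance with $n$ sensors, halts with an optimal solution $(y_1,\ldots,y_n)$, and whose worst-case running time over the instances with $n$ sensors is $O(n^2\log n)$. Here a real RAM is a random access machine with unit-cost arithmetic ($+,-,\times,\div$) and comparisons on real numbers, unit-cost indirect addressing, and unit-cost addition, (truncated) subtraction, halving (rounding down) and comparison of natural numbers; rounding of real numbers is not available. -/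

import Mathlib

/-! ### The real RAM

Programs of a random access machine with exact real arithmetic.  The memory consists of arrays of
natural numbers (used for counters, indices and pointers) and arrays of real numbers, all with
indirect addressing; a fixed program mentions only finitely many arrays.  Every arithmetic
operation, memory access, constant, comparison and assignment costs one unit of time.  There is no
rounding, no conversion of real numbers to natural numbers, and no multiplication of natural
numbers. -/

namespace RealRAM

/-- Index expressions. -/
inductive NExpr : Type
  | const (k : ℕ)
  | get (a : ℕ) (i : NExpr)
  | add (e f : NExpr)
  | sub (e f : NExpr)
  | half (e : NExpr)

/-- Real arithmetic expressions; the only constants are rational. -/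
inductive RExpr : Type
  | const (q : ℚ)
  | get (a : ℕ) (i : NExpr)
  | add (e f : RExpr)
  | sub (e f : RExpr)
  | mul (e f : RExpr)
  | div (e f : RExpr)

/-- Tests for branching. -/
inductive Test : Type
  | natLe (e f : NExpr)
  | natLt (e f : NExpr)
  | realLe (e f : RExpr)
  | realLt (e f : RExpr)

/-- Programs.  `setNat a i e` is the assignment `a[i] := e` in the `a`-th array of natural numbers,
and `setReal a i e` is the same for the `a`-th array of real numbers. -/
inductive Prog : Type
  | skip
  | setNat (a : ℕ) (i : NExpr) (e : NExpr)
  | setReal (a : ℕ) (i : NExpr) (e : RExpr)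
  | seq (P Q : Prog)
  | cond (b : Test) (P Q : Prog)
  | loop (b : Test) (P : Prog)

/-- The contents of the memory: `nat a i` and `real a i` are the `i`-th cells of the `a`-th
arrays. -/
structure State : Type where
  nat : ℕ → ℕ → ℕ
  real : ℕ → ℕ → ℝ

/-- Value of an index expression (subtraction is truncated at `0`, halving rounds down). -/
def NExpr.eval (s : State) : NExpr → ℕ
  | const k => k
  | get a i => s.nat a (i.eval s)
  | add e f => e.eval s + f.eval s
  | sub e f => e.eval s - f.eval s
  | half e => e.eval s / 2

/-- Number of unit-cost operations in an index expression. -/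
def NExpr.cost : NExpr → ℕ
  | const _ => 1
  | get _ i => i.cost + 1
  | add e f => e.cost + f.cost + 1
  | sub e f => e.cost + f.cost + 1
  | half e => e.cost + 1

/-- Value of a real expression (the quotient by `0` is `0`). -/
noncomputable def RExpr.eval (s : State) : RExpr → ℝ
  | const q => (q : ℝ)
  | get a i => s.real a (i.eval s)
  | add e f => e.eval s + f.eval s
  | sub e f => e.eval s - f.eval s
  | mul e f => e.eval s * f.eval s
  | div e f => e.eval s / f.eval s

/-- Number of unit-cost operations in a real expression. -/
def RExpr.cost : RExpr → ℕ
  | const _ => 1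
  | get _ i => i.cost + 1
  | add e f => e.cost + f.cost + 1
  | sub e f => e.cost + f.cost + 1
  | mul e f => e.cost + f.cost + 1
  | div e f => e.cost + f.cost + 1

/-- Truth of a test. -/
def Test.Holds (s : State) : Test → Prop
  | natLe e f => e.eval s ≤ f.eval s
  | natLt e f => e.eval s < f.eval s
  | realLe e f => e.eval s ≤ f.eval s
  | realLt e f => e.eval s < f.eval s

/-- Number of unit-cost operations in a test. -/
def Test.cost : Test → ℕ
  | natLe e f => e.cost + f.cost + 1
  | natLt e f => e.cost + f.cost + 1
  | realLe e f => e.cost + f.cost + 1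
  | realLt e f => e.cost + f.cost + 1

/-- Write `v` into the `i`-th cell of the `a`-th array of natural numbers. -/
def State.writeNat (s : State) (a i v : ℕ) : State :=
  { s with nat := Function.update s.nat a (Function.update (s.nat a) i v) }

/-- Write `v` into the `i`-th cell of the `a`-th array of real numbers. -/
def State.writeReal (s : State) (a i : ℕ) (v : ℝ) : State :=
  { s with real := Function.update s.real a (Function.update (s.real a) i v) }

/-- `Run P s t s'`: started in memory state `s`, the program `P` halts after exactly `t` units of
time in memory state `s'`. -/
inductive Run : Prog → State → ℕ → State → Prop
  | skip (s : State) : Run Prog.skip s 1 s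
  | setNat (a : ℕ) (i e : NExpr) (s : State) :
      Run (Prog.setNat a i e) s (i.cost + e.cost + 1) (s.writeNat a (i.eval s) (e.eval s))
  | setReal (a : ℕ) (i : NExpr) (e : RExpr) (s : State) :
      Run (Prog.setReal a i e) s (i.cost + e.cost + 1) (s.writeReal a (i.eval s) (e.eval s))
  | seq {P Q : Prog} {s s' s'' : State} {t t' : ℕ} :
      Run P s t s' → Run Q s' t' s'' → Run (Prog.seq P Q) s (t + t') s''
  | condTrue {b : Test} {P Q : Prog} {s s' : State} {t : ℕ} :
      b.Holds s → Run P s t s' → Run (Prog.cond b P Q) s (b.cost + t) s'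
  | condFalse {b : Test} {P Q : Prog} {s s' : State} {t : ℕ} :
      ¬ b.Holds s → Run Q s t s' → Run (Prog.cond b P Q) s (b.cost + t) s'
  | loopTrue {b : Test} {P : Prog} {s s' s'' : State} {t t' : ℕ} :
      b.Holds s → Run P s t s' → Run (Prog.loop b P) s' t' s'' →
        Run (Prog.loop b P) s (b.cost + t + t') s''
  | loopFalse {b : Test} {P : Prog} {s : State} :
      ¬ b.Holds s → Run (Prog.loop b P) s b.cost s

end RealRAM

/-! ### Barrier coverage on a line segment -/

namespace BCLS

/-- An instance with `n` sensors: the barrier is `[0, L]`, and sensor `i` is initially at `x i` and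
has range `r i`. -/
structure Input (n : ℕ) : Type where
  L : ℝ
  x : Fin n → ℝ
  r : Fin n → ℝ
  L_pos : 0 < L
  r_pos : ∀ i, 0 < r i
  x_mono : Monotone x
  enough : L ≤ 2 * ∑ i, r i

/-- With the sensors at the positions `y`, every point of the barrier is covered. -/
def Input.Covers {n : ℕ} (I : Input n) (y : Fin n → ℝ) : Prop :=
  ∀ p ∈ Set.Icc (0 : ℝ) I.L, ∃ i, p ∈ Set.Icc (y i - I.r i) (y i + I.r i)

/-- The maximum moving distance of the sensors, a maximum over the finite index set. -/
noncomputable def Input.maxMove {n : ℕ} (I : Input n) (y : Fin n → ℝ) : ℝ :=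
  ⨆ i, |I.x i - y i|

/-- The destinations `y` form a coverage and minimize the maximum moving distance among all
destinations that do. -/
def Input.IsOptimal {n : ℕ} (I : Input n) (y : Fin n → ℝ) : Prop :=
  I.Covers y ∧ ∀ y' : Fin n → ℝ, I.Covers y' → I.maxMove y ≤ I.maxMove y'

/-- The initial memory: `n` is in cell `0` of array `0` of the natural numbers, `L` is in cell `0`
of array `0` of the real numbers, the initial positions are in array `1` and the ranges in array
`2`; all other cells contain `0`. -/
noncomputable def Input.load {n : ℕ} (I : Input n) : RealRAM.State where
  nat := fun a i => if a = 0 ∧ i = 0 then n else 0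
  real := fun a i =>
    if a = 0 ∧ i = 0 then I.L
    else if h : i < n then
      if a = 1 then I.x ⟨i, h⟩ else if a = 2 then I.r ⟨i, h⟩ else 0
    else 0

/-- The destinations that a program returns, read from array `3` of the real numbers. -/
def readOutput (n : ℕ) (s : RealRAM.State) : Fin n → ℝ :=
  fun i => s.real 3 i

/-- The program `P` solves the problem, on every instance with `n` sensors within `T n` units of
time. -/
def SolvesWithin (P : RealRAM.Prog) (T : ℕ → ℕ) : Prop :=
  ∀ (n : ℕ) (I : Input n), ∃ (t : ℕ) (s : RealRAM.State),
    RealRAM.Run P I.load t s ∧ t ≤ T n ∧ I.IsOptimal (readOutput n s)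

end BCLS

/-! Fix a bound `lam` on the moves. Once the barrier is covered up to `R`, sensor `i` is usable as
soon as `R` reaches its release `x i - r i - lam`, and it then pushes the end to `min (R + 2 * r i)
(x i + r i + lam)`, or does nothing if its deadline `x i + r i + lam` has passed. Feasibility of
`lam` is thus a scheduling question on one machine. `feas_of_cover` turns a coverage into a
schedule, and an exchange argument (`advance_exchange`, `Feas.earliest_deadline`) shows that using
the released sensor with the earliest deadline is never wrong. The resulting greedy algorithm is
idle after `2 * n` steps (`Conf.idle_iterate`), and it reaches `L` exactly when `lam` is feasible
(`Ranking.le_final_iff`). With a binary tree of counters as priority queue it takes O(n log n) time.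

The optimum comes from parametric search. The orders by release and by deadline do not depend on
`lam`, and the covered end always has the form `c + s * lam` with `s` equal to 0 or 1. So each
branch of the greedy algorithm either is independent of `lam` or asks whether `q ≤ lam` for a number
`q` computed without `lam`. The algorithm is run on these symbolic values, and each `q` is answered
by the decision procedure: it counts as below the parameter if it is negative or infeasible. These
are O(n) queries at O(n log n) each.

`Ranking.exists_query_le` shows that, with the extra queries 0 and `(L - c) / s`, the least feasible
nonnegative query is optimal. Otherwise some feasible `mu ≥ 0` is smaller than all of them. Let
`lam` be the largest infeasible nonnegative query. The runs with parameters `lam` and `mu` receive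
the same answers and end with the same `c` and `s`, while `c + s * lam < L ≤ c + s * mu`. Hence `s =
1`, and `L - c` is a query in the interval from `lam` (excluded) to `mu`, where there is none.
Existence of a minimum is part of the conclusion, so no compactness argument is needed.

What remains is a small program logic with time bounds (`WP`), in which the programs are shown to
follow this mathematics step by step. -/

/-! ### Program logic: time-bounded total correctness, loop-free blocks, framing and for-loops. -/

namespace RealRAM

/-- Started in `s`, the program `P` halts within `B` units of time in a state satisfying `Q`. -/
def WP (P : Prog) (B : ℕ) (Q : State → Prop) (s : State) : Prop :=
  ∃ t s', Run P s t s' ∧ t ≤ B ∧ Q s'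

theorem WP.mono {P : Prog} {B B' : ℕ} {Q Q' : State → Prop} {s : State}
    (h : WP P B Q s) (hB : B ≤ B') (hQ : ∀ s', Q s' → Q' s') : WP P B' Q' s := by
  obtain ⟨t, s', hr, ht, hq⟩ := h
  exact ⟨t, s', hr, ht.trans hB, hQ _ hq⟩

theorem WP.seq {P P' : Prog} {B B' : ℕ} {Q : State → Prop} {s : State}
    (h : WP P B (WP P' B' Q) s) : WP (P.seq P') (B + B') Q s := by
  obtain ⟨t, s', hr, ht, t', s'', hr', ht', hq⟩ := h
  exact ⟨t + t', s'', Run.seq hr hr', by omega, hq⟩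

theorem WP.cond {b : Test} {P P' : Prog} {B : ℕ} {Q : State → Prop} {s : State}
    (h : b.Holds s → WP P B Q s) (h' : ¬ b.Holds s → WP P' B Q s) :
    WP (Prog.cond b P P') (b.cost + B) Q s := by
  by_cases hb : b.Holds s
  · obtain ⟨t, s', hr, ht, hq⟩ := h hb
    exact ⟨_, s', Run.condTrue hb hr, by omega, hq⟩
  · obtain ⟨t, s', hr, ht, hq⟩ := h' hb
    exact ⟨_, s', Run.condFalse hb hr, by omega, hq⟩

/-- The index of the invariant is fuel: it bounds the number of remaining iterations. The loop may
stop with fuel left, so the final index is only known to exist. -/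
theorem WP.loop {b : Test} {P : Prog} {B : ℕ} (Inv : ℕ → State → Prop)
    (h0 : ∀ s, Inv 0 s → ¬ b.Holds s)
    (hs : ∀ k s, Inv (k + 1) s → b.Holds s → WP P B (Inv k) s) :
    ∀ {k : ℕ} {s : State}, Inv k s →
      WP (Prog.loop b P) (k * (b.cost + B) + b.cost)
        (fun s' => (∃ k', Inv k' s') ∧ ¬ b.Holds s') s := by
  intro k
  induction k with
  | zero =>
    intro s h
    exact ⟨_, s, Run.loopFalse (h0 s h), by omega, ⟨0, h⟩, h0 s h⟩
  | succ k ih =>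
    intro s h
    by_cases hb : b.Holds s
    · obtain ⟨t, s', hr, ht, hq⟩ := hs k s h hb
      obtain ⟨t', s'', hr', ht', hq'⟩ := ih hq
      refine ⟨_, s'', Run.loopTrue hb hr hr', ?_, hq'⟩
      have : (k + 1) * (b.cost + B) = k * (b.cost + B) + (b.cost + B) := by ring
      omega
    · exact ⟨_, s, Run.loopFalse hb, by omega, ⟨_, h⟩, hb⟩

/-- Programs without loops. -/
def Prog.LoopFree : Prog → Prop
  | skip => True
  | setNat _ _ _ => True
  | setReal _ _ _ => True
  | seq P Q => P.LoopFree ∧ Q.LoopFree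
  | cond _ P Q => P.LoopFree ∧ Q.LoopFree
  | loop _ _ => False

/-- An upper bound for the running time of a program without loops. -/
def Prog.cost : Prog → ℕ
  | skip => 1
  | setNat _ i e => i.cost + e.cost + 1
  | setReal _ i e => i.cost + e.cost + 1
  | seq P Q => P.cost + Q.cost
  | cond b P Q => b.cost + P.cost + Q.cost
  | loop _ _ => 0

open Classical in
/-- The final state of a program without loops. -/
noncomputable def Prog.exec : Prog → State → State
  | skip, s => s
  | setNat a i e, s => s.writeNat a (i.eval s) (e.eval s)
  | setReal a i e, s => s.writeReal a (i.eval s) (e.eval s)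
  | seq P Q, s => Q.exec (P.exec s)
  | cond b P Q, s => if b.Holds s then P.exec s else Q.exec s
  | loop _ _, s => s

/-- Loop-free code always halts and its final state is a computable expression, so later
specifications of such blocks reduce to `simp` on `Prog.exec`. -/
theorem WP.block {P : Prog} (hP : P.LoopFree) {Q : State → Prop} {s : State}
    (h : Q (P.exec s)) : WP P P.cost Q s := by
  suffices H : ∀ (P : Prog), P.LoopFree → ∀ s, ∃ t, Run P s t (P.exec s) ∧ t ≤ P.cost by
    obtain ⟨t, hr, ht⟩ := H P hP s
    exact ⟨t, _, hr, ht, h⟩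
  intro P
  induction P with
  | skip => exact fun _ s => ⟨_, Run.skip s, le_rfl⟩
  | setNat a i e => exact fun _ s => ⟨_, Run.setNat a i e s, le_rfl⟩
  | setReal a i e => exact fun _ s => ⟨_, Run.setReal a i e s, le_rfl⟩
  | seq P Q ihP ihQ =>
    intro h s
    obtain ⟨t, hr, ht⟩ := ihP h.1 s
    obtain ⟨t', hr', ht'⟩ := ihQ h.2 (P.exec s)
    exact ⟨_, Run.seq hr hr', by simp only [Prog.cost]; omega⟩
  | cond b P Q ihP ihQ =>
    intro h s
    by_cases hb : b.Holds s
    · obtain ⟨t, hr, ht⟩ := ihP h.1 s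
      refine ⟨b.cost + t, ?_, ?_⟩
      · simp only [Prog.exec, hb, if_true]; exact Run.condTrue hb hr
      · simp only [Prog.cost]; omega
    · obtain ⟨t, hr, ht⟩ := ihQ h.2 s
      refine ⟨b.cost + t, ?_, ?_⟩
      · simp only [Prog.exec, hb, if_false]; exact Run.condFalse hb hr
      · simp only [Prog.cost]; omega
  | loop b P _ => exact fun h => h.elim

/-- All assignments are to arrays of naturals in `SN` or arrays of reals in `SR`. -/
def Prog.WritesIn (SN SR : Set ℕ) : Prog → Prop
  | skip => True
  | setNat a _ _ => a ∈ SN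
  | setReal a _ _ => a ∈ SR
  | seq P Q => P.WritesIn SN SR ∧ Q.WritesIn SN SR
  | cond _ P Q => P.WritesIn SN SR ∧ Q.WritesIn SN SR
  | loop _ P => P.WritesIn SN SR

/-- The states agree outside the arrays of naturals in `SN` and the arrays of reals in `SR`. -/
def Agree (SN SR : Set ℕ) (s s' : State) : Prop :=
  (∀ a, a ∉ SN → s'.nat a = s.nat a) ∧ (∀ a, a ∉ SR → s'.real a = s.real a)

theorem Agree.refl (SN SR : Set ℕ) (s : State) : Agree SN SR s s :=
  ⟨fun _ _ => rfl, fun _ _ => rfl⟩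

theorem Agree.trans {SN SR : Set ℕ} {s s' s'' : State} (h : Agree SN SR s s')
    (h' : Agree SN SR s' s'') : Agree SN SR s s'' :=
  ⟨fun a ha => (h'.1 a ha).trans (h.1 a ha), fun a ha => (h'.2 a ha).trans (h.2 a ha)⟩

theorem Agree.mono {SN SR SN' SR' : Set ℕ} {s s' : State} (h : Agree SN SR s s')
    (hN : SN ⊆ SN') (hR : SR ⊆ SR') : Agree SN' SR' s s' :=
  ⟨fun a ha => h.1 a fun h' => ha (hN h'), fun a ha => h.2 a fun h' => ha (hR h')⟩

theorem Run.agree {P : Prog} {s s' : State} {t : ℕ} (h : Run P s t s') {SN SR : Set ℕ}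
    (hP : P.WritesIn SN SR) : Agree SN SR s s' := by
  induction h with
  | skip s => exact Agree.refl _ _ _
  | setNat a i e s =>
    refine ⟨fun b hb => ?_, fun _ _ => rfl⟩
    exact Function.update_of_ne (by rintro rfl; exact hb hP) _ _
  | setReal a i e s =>
    refine ⟨fun _ _ => rfl, fun b hb => ?_⟩
    exact Function.update_of_ne (by rintro rfl; exact hb hP) _ _
  | seq _ _ ih ih' => exact (ih hP.1).trans (ih' hP.2)
  | condTrue _ _ ih => exact ih hP.1
  | condFalse _ _ ih => exact ih hP.2
  | loopTrue _ _ _ ih ih' => exact (ih hP).trans (ih' hP)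
  | loopFalse _ => exact Agree.refl _ _ _

/-- Which arrays survive is visible in the program text. Specifications therefore need to mention
only what changes, and `simp` checks the rest. -/
theorem WP.frame {P : Prog} {B : ℕ} {Q : State → Prop} {s : State} (h : WP P B Q s)
    {SN SR : Set ℕ} (hP : P.WritesIn SN SR) : WP P B (fun s' => Q s' ∧ Agree SN SR s s') s := by
  obtain ⟨t, s', hr, ht, hq⟩ := h
  exact ⟨t, s', hr, ht, hq, hr.agree hP⟩

theorem State.nat_writeNat (s : State) (a i v b j : ℕ) :
    (s.writeNat a i v).nat b j = if b = a ∧ j = i then v else s.nat b j := by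
  by_cases hb : b = a
  · subst hb
    by_cases hj : j = i <;> simp [State.writeNat, hj]
  · simp [State.writeNat, hb]

theorem State.nat_writeNat_of_ne {a b : ℕ} (h : b ≠ a) (s : State) (i v : ℕ) :
    (s.writeNat a i v).nat b = s.nat b := Function.update_of_ne h _ _

theorem State.real_writeReal_of_ne {a b : ℕ} (h : b ≠ a) (s : State) (i : ℕ) (v : ℝ) :
    (s.writeReal a i v).real b = s.real b := Function.update_of_ne h _ _

theorem State.real_writeNat (s : State) (a i v : ℕ) : (s.writeNat a i v).real = s.real := rfl

theorem State.nat_writeReal (s : State) (a i : ℕ) (v : ℝ) : (s.writeReal a i v).nat = s.nat := rfl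

theorem State.real_writeReal (s : State) (a i : ℕ) (v : ℝ) (b j : ℕ) :
    (s.writeReal a i v).real b j = if b = a ∧ j = i then v else s.real b j := by
  by_cases hb : b = a
  · subst hb
    by_cases hj : j = i <;> simp [State.writeReal, hj]
  · simp [State.writeReal, hb]

/-- The natural number variable stored in cell `0` of array `a`. -/
abbrev NExpr.var (a : ℕ) : NExpr := .get a (.const 0)

/-- The real variable stored in cell `0` of array `a`. -/
abbrev RExpr.var (a : ℕ) : RExpr := .get a (.const 0)

/-- `for v = 0, …, E - 1 do P`. -/
def Prog.forLoop (v : ℕ) (E : NExpr) (P : Prog) : Prog :=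
  .seq (.setNat v (.const 0) (.const 0))
    (.loop (.natLt (.var v) E) (.seq P (.setNat v (.const 0) (.add (.var v) (.const 1)))))

theorem WP.forLoop {v : ℕ} {E : NExpr} {P : Prog} {B n : ℕ} (Inv : ℕ → State → Prop) {s : State}
    (hE : ∀ i s, Inv i s → E.eval s = n)
    (h0 : Inv 0 (s.writeNat v 0 0))
    (hs : ∀ i s, i < n → Inv i s → s.nat v 0 = i →
      WP P B (fun s' => s'.nat v 0 = i ∧ Inv (i + 1) (s'.writeNat v 0 (i + 1))) s) :
    WP (Prog.forLoop v E P) ((n + 1) * (B + E.cost + 9)) (Inv n) s := by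
  have key : WP (.loop (.natLt (.var v) E) (.seq P (.setNat v (.const 0) (.add (.var v) (.const 1)))))
      (n * ((Test.natLt (.var v) E).cost + (B + 6)) + (Test.natLt (.var v) E).cost)
      (Inv n) (s.writeNat v 0 0) := by
    -- The increment of the counter costs 6; the fuel `k` is the number of rounds still to come, so
    -- the counter is `n - k`.
    refine (WP.loop (B := B + 6) (fun k s => k ≤ n ∧ Inv (n - k) s ∧ s.nat v 0 = n - k)
      ?_ ?_ (k := n) ?_).mono le_rfl ?_
    · rintro s ⟨-, hI, hv⟩ hb
      have := hE _ _ hI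
      simp only [Test.Holds, NExpr.eval] at hb
      omega
    · rintro k s ⟨hk, hI, hv⟩ -
      refine WP.seq ((hs (n - (k + 1)) s (by omega) hI hv).mono le_rfl ?_)
      rintro s' ⟨hv', hI'⟩
      refine ⟨_, _, Run.setNat _ _ _ _, by simp [NExpr.cost], by omega, ?_, ?_⟩
      · have : n - k = n - (k + 1) + 1 := by omega
        simpa [NExpr.eval, hv', this] using hI'
      · simp [NExpr.eval, hv', State.nat_writeNat]
        omega
    · exact ⟨le_rfl, by simpa using h0, by simp [State.nat_writeNat]⟩
    · rintro s' ⟨⟨k, hk, hI, hv⟩, hb⟩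
      have := hE _ _ hI
      simp only [Test.Holds, NExpr.eval] at hb
      have : k = 0 := by omega
      subst this
      simpa using hI
  refine (WP.seq (B := 3)
    (B' := n * ((Test.natLt (.var v) E).cost + (B + 6)) + (Test.natLt (.var v) E).cost)
    ⟨_, _, Run.setNat _ _ _ _, by simp [NExpr.cost], ?_⟩).mono ?_ fun _ h => h
  · simpa [NExpr.eval] using key
  · simp only [Test.cost, NExpr.cost]
    nlinarith

end RealRAM

/-! ### Scheduling for a fixed parameter: the earliest deadline first rule. -/

namespace BCLS

section Schedule

variable {ι : Type*}

/-- The end of the covered part of the barrier after sensor `i` was placed greedily, when `R` was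
the end before. -/
noncomputable def advance (x r : ι → ℝ) (lam R : ℝ) (i : ι) : ℝ :=
  max R (min (R + 2 * r i) (x i + r i + lam))

variable {x r : ι → ℝ} {lam L : ℝ}

theorem le_advance (R : ℝ) (i : ι) : R ≤ advance x r lam R i := le_max_left _ _

theorem advance_mono {R R' : ℝ} (h : R ≤ R') (i : ι) :
    advance x r lam R i ≤ advance x r lam R' i :=
  max_le_max h (min_le_min (by linarith) le_rfl)

theorem le_foldl_advance (B : List ι) (R : ℝ) : R ≤ B.foldl (advance x r lam) R := by
  induction B generalizing R with
  | nil => exact le_rfl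
  | cons b B ih => exact (le_advance R b).trans (ih _)

/-- Each placement is nondecreasing and 1-Lipschitz in the covered end, so a deficit of `δ` never
grows. -/
theorem foldl_advance_sub_le {B : List ι} {V W δ : ℝ} (h : W - δ ≤ V) (hδ : 0 ≤ δ) :
    B.foldl (advance x r lam) W - δ ≤ B.foldl (advance x r lam) V := by
  induction B generalizing V W with
  | nil => exact h
  | cons b B ih =>
    refine ih ?_
    simp only [advance]
    rcases max_cases W (min (W + 2 * r b) (x b + r b + lam)) with ⟨h1, -⟩ | ⟨h1, -⟩ <;> rw [h1]
    · exact h.trans (le_max_left _ _)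
    · refine le_trans ?_ (le_max_right _ _)
      rw [← min_sub_sub_right]
      exact min_le_min (by linarith) (by linarith)

/-- A lead of `δ` can only be lost where a deadline cuts a sensor off, and no deadline lies below
`D`. Up to the level `D` the lead therefore persists. -/
theorem min_le_foldl_advance {B : List ι} {V W δ D : ℝ} (h : min (W + δ) D ≤ V)
    (hr : ∀ b ∈ B, 0 < r b) (hB : ∀ b ∈ B, D ≤ x b + r b + lam) :
    min (B.foldl (advance x r lam) W + δ) D ≤ B.foldl (advance x r lam) V := by
  induction B generalizing V W with
  | nil => exact h
  | cons b B ih =>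
    refine ih ?_ (fun i hi => hr i (by simp [hi])) fun i hi => hB i (by simp [hi])
    have hb := hB b (by simp)
    have hrb := hr b (by simp)
    have h1 : advance x r lam W b ≤ W + 2 * r b :=
      max_le (by linarith) (min_le_left _ _)
    refine le_trans ?_ (le_max_right _ _)
    refine le_min ?_ ((min_le_right _ _).trans hb)
    rcases min_le_iff.1 h with h2 | h2
    · exact (min_le_left _ _).trans (by linarith)
    · exact (min_le_right _ _).trans (by linarith)

theorem foldl_advance_le {B : List ι} {W M : ℝ} (h : W ≤ M)
    (hB : ∀ b ∈ B, x b + r b + lam ≤ M) : B.foldl (advance x r lam) W ≤ M := by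
  induction B generalizing W with
  | nil => exact h
  | cons b B ih =>
    exact ih (max_le h ((min_le_right _ _).trans (hB b (by simp))))
      fun i hi => hB i (by simp [hi])

/-- Moving `j` to the front and `i` to the back of a greedy part of a schedule. -/
theorem advance_exchange (hr : ∀ i, 0 < r i) {R : ℝ} {i j : ι} {B : List ι}
    (hij : x j + r j ≤ x i + r i) (hi : x i - r i - lam ≤ R)
    (hB : ∀ b ∈ B, x b + r b ≤ x j + r j ∧ R < x b - r b - lam) :
    advance x r lam (B.foldl (advance x r lam) (advance x r lam R i)) j ≤
      advance x r lam (B.foldl (advance x r lam) (advance x r lam R j)) i := by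
  have hri := hr i
  have hrj := hr j
  -- If `i` alone gets past the deadline of `j`, then all of `B` and `j` are too late to contribute.
  rcases le_or_gt (x j + r j + lam) (advance x r lam R i) with hX | hX
  · have h1 : B.foldl (advance x r lam) (advance x r lam R i) ≤ advance x r lam R i :=
      foldl_advance_le le_rfl fun b hb => by linarith [(hB b hb).1]
    refine (max_le h1 ((min_le_right _ _).trans hX)).trans
      (advance_mono ((le_advance R j).trans (le_foldl_advance _ _)) i)
  · have hRX := le_advance (x := x) (r := r) (lam := lam) R i
    -- Here `i` ends before the deadline of `j`, hence before its own, so it contributes its full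
    -- length.
    have hXe : advance x r lam R i = R + 2 * r i := by
      simp only [advance] at hX ⊢
      have h1 := (le_max_right _ _).trans_lt hX
      rcases min_lt_iff.1 h1 with h2 | h2
      · rw [min_eq_left (by linarith), max_eq_right (by linarith)]
      · linarith
    have hT : B.foldl (advance x r lam) (advance x r lam R i) ≤ x j + r j + lam :=
      foldl_advance_le hX.le fun b hb => by linarith [(hB b hb).1]
    set TX := B.foldl (advance x r lam) (advance x r lam R i) with hTX
    have hl : advance x r lam TX j ≤ min (TX + 2 * r j) (x j + r j + lam) :=
      max_le (le_min (by linarith) hT) le_rfl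
    -- The old order cannot end beyond the deadline of `j`. If `j` placed first already gets there,
    -- nothing is lost.
    rcases le_or_gt (x j + r j + lam) (R + 2 * r j) with hY | hY
    · have : x j + r j + lam ≤ advance x r lam R j := (le_min hY le_rfl).trans (le_max_right _ _)
      exact hl.trans ((min_le_right _ _).trans
        (this.trans ((le_foldl_advance _ _).trans (le_advance _ _))))
    · have hYe : advance x r lam R j = R + 2 * r j := by
        simp only [advance]
        rw [min_eq_left hY.le, max_eq_right (by linarith)]
      refine hl.trans (le_trans ?_ (le_max_right _ _))
      refine le_min ?_ ((min_le_right _ _).trans (by linarith))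
      -- Both first sensors now contribute fully. If `j` is shorter, the deficit `2 * (r i - r j)`
      -- is repaid when `i` follows at the end.
      rcases le_or_gt (r j) (r i) with hc | hc
      · have := foldl_advance_sub_le (x := x) (r := r) (lam := lam) (B := B)
          (W := advance x r lam R i) (V := advance x r lam R j) (δ := 2 * (r i - r j))
          (by rw [hXe, hYe]; linarith) (by linarith)
        exact (min_le_left _ _).trans (by linarith)
      -- If `j` is longer, its lead must survive `B` up to the level from which `i` still reaches
      -- the deadline of `j`. No `b` has a deadline below that level: `i` was released at `R` but
      -- `b` was not, so `x j + r j + lam - 2 * r i ≤ x i - r i + lam ≤ R + 2 * lam < x b + r b +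
      -- lam`.
      · have := min_le_foldl_advance (x := x) (r := r) (lam := lam) (B := B)
          (W := advance x r lam R i) (V := advance x r lam R j) (δ := 2 * (r j - r i))
          (D := x j + r j + lam - 2 * r i)
          ((min_le_left _ _).trans (by rw [hXe, hYe]; linarith)) (fun b _ => hr b)
          (fun b hb => by linarith [(hB b hb).2, hr b])
        rcases min_le_iff.1 this with h2 | h2
        · exact (min_le_left _ _).trans (by linarith)
        · exact (min_le_right _ _).trans (by linarith)

variable [DecidableEq ι]

/-- With moves of length at most `lam`, the sensors in `U` can be placed one by one to extend the
covered part from `R` to `L`. -/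
inductive Feas (x r : ι → ℝ) (lam L : ℝ) : Finset ι → ℝ → Prop
  | done {U : Finset ι} {R : ℝ} : L ≤ R → Feas x r lam L U R
  | move {U : Finset ι} {R : ℝ} (i : ι) : i ∈ U → x i - r i - lam ≤ R →
      Feas x r lam L (U.erase i) (advance x r lam R i) → Feas x r lam L U R

theorem Feas.mono {U : Finset ι} {R : ℝ} (h : Feas x r lam L U R) :
    ∀ {U' : Finset ι} {R' : ℝ}, U ⊆ U' → R ≤ R' → Feas x r lam L U' R' := by
  induction h with
  | done h => exact fun _ hR => .done (h.trans hR)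
  | move i hi ha _ ih =>
    exact fun hU hR => .move i (hU hi) (ha.trans hR)
      (ih (Finset.erase_subset_erase _ hU) (advance_mono hR i))

/-- Sensors released at `R` stay released as the covered end grows, so the list may be placed in any
order. -/
theorem Feas.of_foldl {B : List ι} : ∀ {U : Finset ι} {R : ℝ}, B.Nodup → (∀ b ∈ B, b ∈ U) →
    (∀ b ∈ B, x b - r b - lam ≤ R) →
    Feas x r lam L (U \ B.toFinset) (B.foldl (advance x r lam) R) → Feas x r lam L U R := by
  induction B with
  | nil => intro U R _ _ _ h; simpa using h
  | cons b B ih =>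
    intro U R hnd hU hR h
    rw [List.nodup_cons] at hnd
    refine .move b (hU b (by simp)) (hR b (by simp)) (ih hnd.2 ?_ ?_ ?_)
    · intro i hi
      exact Finset.mem_erase.2 ⟨fun h => hnd.1 (h ▸ hi), hU i (by simp [hi])⟩
    · exact fun i hi => (hR i (by simp [hi])).trans (le_advance R b)
    · refine h.mono ?_ le_rfl
      intro i
      simp only [List.toFinset_cons, Finset.mem_sdiff, Finset.mem_insert, Finset.mem_erase]
      tauto

variable {key : ι → ℕ}

/-- Placing a released sensor with the earliest deadline is never a mistake. -/
theorem Feas.earliest_deadline (hlam : 0 ≤ lam) (hr : ∀ i, 0 < r i)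
    (hkey : ∀ i j, key i ≤ key j → x i + r i ≤ x j + r j) (hinj : Function.Injective key)
    {U : Finset ι} {R : ℝ} (h : Feas x r lam L U R) {j : ι} (hj : j ∈ U)
    (hjR : x j - r j - lam ≤ R)
    (hmin : ∀ i ∈ U, key i < key j → R < x i - r i - lam) :
    Feas x r lam L (U.erase j) (advance x r lam R j) := by
  -- The induction hypothesis is applied to the part of the schedule after its first sensor, which
  -- uses fewer sensors.
  induction hm : U.card using Nat.strong_induction_on generalizing U R j with
  | _ m IH =>
  -- By induction, a later part of the schedule may be put into greedy order until `j` is placed.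
  have chain : ∀ (k : ℕ), k < m → ∀ (V : Finset ι) (S : ℝ), V.card = k → j ∈ V →
      x j - r j - lam ≤ S → Feas x r lam L V S →
      ∃ B : List ι, B.Nodup ∧ (∀ b ∈ B, b ∈ V ∧ key b < key j) ∧
        Feas x r lam L ((V \ B.toFinset).erase j)
          (advance x r lam (B.foldl (advance x r lam) S) j) := by
    intro k
    induction k with
    | zero =>
      intro _ V S hV hjV
      rw [Finset.card_eq_zero.1 hV] at hjV
      simp at hjV
    | succ k ih =>
      intro hk V S hV hjV hjS hF
      have hne : (V.filter fun i => x i - r i - lam ≤ S).Nonempty :=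
        ⟨j, Finset.mem_filter.2 ⟨hjV, hjS⟩⟩
      obtain ⟨b, hb, hbmin⟩ := Finset.exists_min_image _ key hne
      rw [Finset.mem_filter] at hb
      have hF' := IH (k + 1) hk hF hb.1 hb.2 (fun i hi hlt => by
        by_contra hcon
        have := hbmin i (Finset.mem_filter.2 ⟨hi, not_lt.1 hcon⟩)
        omega) hV
      by_cases hbj : b = j
      · subst hbj
        exact ⟨[], List.nodup_nil, by simp, by simpa using hF'⟩
      · have hlt : key b < key j :=
          lt_of_le_of_ne (hbmin j (Finset.mem_filter.2 ⟨hjV, hjS⟩)) fun h => hbj (hinj h)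
        obtain ⟨B, hBnd, hB, hBF⟩ := ih (by omega) (V.erase b) _
          (by rw [Finset.card_erase_of_mem hb.1]; omega)
          (Finset.mem_erase.2 ⟨fun h => hbj h.symm, hjV⟩) (hjS.trans (le_advance S b)) hF'
        refine ⟨b :: B, ?_, ?_, ?_⟩
        · exact List.nodup_cons.2 ⟨fun h => Finset.notMem_erase b V (hB b h).1, hBnd⟩
        · intro i hi
          rcases List.mem_cons.1 hi with rfl | hi
          · exact ⟨hb.1, hlt⟩
          · exact ⟨Finset.mem_of_mem_erase (hB i hi).1, (hB i hi).2⟩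
        · refine hBF.mono ?_ le_rfl
          intro i
          simp only [List.toFinset_cons, Finset.mem_sdiff, Finset.mem_insert, Finset.mem_erase]
          tauto
  cases h with
  | done h => exact .done (h.trans (le_advance R j))
  | move i hi hiR hF =>
    by_cases hij : i = j
    · subst hij; exact hF
    have hkij : key j ≤ key i := by
      by_contra hcon
      exact absurd hiR (not_le.2 (hmin i hi (by omega)))
    have hdij := hkey _ _ hkij
    -- The schedule now reads `i`, `B`, `j`, rest, where `B` precedes `j` in deadline order. It is
    -- replaced by `j`, `B`, `i`, rest.
    obtain ⟨B, hBnd, hB, hBF⟩ := chain (U.erase i).card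
      (by rw [← hm]; exact Finset.card_erase_lt_of_mem hi) (U.erase i) _ rfl
      (Finset.mem_erase.2 ⟨fun h => hij h.symm, hj⟩) (hjR.trans (le_advance R i)) hF
    have hBmem : ∀ b ∈ B, b ∈ U ∧ b ≠ i ∧ b ≠ j := fun b hb =>
      ⟨Finset.mem_of_mem_erase (hB b hb).1, Finset.ne_of_mem_erase (hB b hb).1,
        fun h => absurd (hB b hb).2 (by simp [h])⟩
    refine Feas.of_foldl (B := B) hBnd
      (fun b hb => Finset.mem_erase.2 ⟨(hBmem b hb).2.2, (hBmem b hb).1⟩) ?_ ?_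
    -- `B` must be released right after `j`. This follows from `x b + r b ≤ x j + r j` together with
    -- the release of `j` at `R` and `0 ≤ lam`.
    · intro b hb
      have h1 := hkey _ _ (hB b hb).2.le
      have h2 := hr b
      refine le_trans ?_ (le_max_right _ _)
      refine le_min ?_ ?_ <;> linarith [hmin b (hBmem b hb).1 (hB b hb).2]
    · refine .move i ?_ (hiR.trans ((le_advance R j).trans (le_foldl_advance _ _))) (hBF.mono ?_ ?_)
      · simp only [Finset.mem_sdiff, Finset.mem_erase, List.mem_toFinset]
        exact ⟨⟨hij, hi⟩, fun h => (hBmem i h).2.1 rfl⟩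
      · intro b
        simp only [Finset.mem_sdiff, Finset.mem_erase]
        tauto
      · exact advance_exchange hr hdij hiR fun b hb =>
          ⟨hkey _ _ (hB b hb).2.le, hmin b (hBmem b hb).1 (hB b hb).2⟩

end Schedule

end BCLS

/-! ### The greedy algorithm as an abstract machine, and its correctness for a given parameter. -/

namespace BCLS

/-- Some coverage moves no sensor by more than `lam`. -/
def Input.Feasible {n : ℕ} (I : Input n) (lam : ℝ) : Prop :=
  ∃ y : Fin n → ℝ, I.Covers y ∧ ∀ i, |I.x i - y i| ≤ lam

theorem Input.Feasible.mono {n : ℕ} {I : Input n} {lam mu : ℝ} (h : I.Feasible lam)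
    (hle : lam ≤ mu) : I.Feasible mu := by
  obtain ⟨y, hy, hm⟩ := h
  exact ⟨y, hy, fun i => (hm i).trans hle⟩

theorem Input.pos {n : ℕ} (I : Input n) : 0 < n := by
  rcases Nat.eq_zero_or_pos n with rfl | h
  · have := I.enough
    have := I.L_pos
    simp at *
    linarith
  · exact h

/-- The sensors are laid end to end from 0 on in the order of their indices; the ranges suffice to
reach `L`. The sum of all moves serves as a crude bound. -/
theorem Input.exists_feasible {n : ℕ} (I : Input n) : ∃ lam, 0 ≤ lam ∧ I.Feasible lam := by
  have hn := I.pos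
  let S : ℕ → ℝ := fun k => 2 * ∑ i : Fin n with i.val < k, I.r i
  let y : Fin n → ℝ := fun i => S i + I.r i
  have hS : ∀ i : Fin n, S (i + 1) = S i + 2 * I.r i := by
    intro i
    have : (Finset.univ.filter fun j : Fin n => j.val < i.val + 1) =
        insert i (Finset.univ.filter fun j : Fin n => j.val < i.val) := by
      ext j
      simp only [Finset.mem_filter, Finset.mem_univ, true_and, Finset.mem_insert, Fin.ext_iff]
      omega
    simp only [S]
    rw [this, Finset.sum_insert (by simp)]
    ring
  refine ⟨∑ i, |I.x i - y i|, Finset.sum_nonneg fun _ _ => abs_nonneg _, y, ?_, fun i =>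
    Finset.single_le_sum (f := fun i => |I.x i - y i|) (fun _ _ => abs_nonneg _)
      (Finset.mem_univ i)⟩
  rintro p ⟨hp0, hpL⟩
  have hex : ∃ k, p ≤ S (k + 1) := by
    refine ⟨n - 1, hpL.trans (I.enough.trans ?_)⟩
    have : (Finset.univ.filter fun j : Fin n => j.val < n - 1 + 1) = Finset.univ := by
      ext j
      simp
      omega
    simp only [S, this]
    exact le_rfl
  classical
  have hk := Nat.find_spec hex
  have hmin : ∀ m < Nat.find hex, S (m + 1) < p := fun m hm => not_le.1 (Nat.find_min hex hm)
  have hkn : Nat.find hex < n := by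
    refine lt_of_le_of_lt (Nat.find_min' hex (m := n - 1) ?_) (by omega)
    have : (Finset.univ.filter fun j : Fin n => j.val < n - 1 + 1) = Finset.univ := by
      ext j
      simp
      omega
    simp only [S, this]
    exact hpL.trans I.enough
  refine ⟨⟨_, hkn⟩, ?_, ?_⟩
  · simp only [y, add_sub_cancel_right]
    rcases Nat.eq_zero_or_pos (Nat.find hex) with h0 | h0
    · simp only [h0, S]
      simpa using hp0
    · have := hmin (Nat.find hex - 1) (by omega)
      rw [Nat.sub_add_cancel h0] at this
      exact this.le
  · have := hS ⟨_, hkn⟩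
    simp only [y] at *
    linarith

/-- The schedule follows the coverage from left to right: some sensor covers `R` and points beyond
it, and placing it greedily reaches at least its right end. It is then useless for the points still
to be covered. -/
theorem feas_of_cover {ι : Type*} [DecidableEq ι] {x r y : ι → ℝ} {lam L : ℝ}
    (hmove : ∀ i, |x i - y i| ≤ lam) {U : Finset ι} {R : ℝ}
    (hcov : ∀ p, R < p → p ≤ L → ∃ i ∈ U, p ∈ Set.Icc (y i - r i) (y i + r i)) :
    Feas x r lam L U R := by
  induction hm : U.card generalizing U R with
  | zero =>
    refine .done (le_of_not_gt fun h => ?_)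
    obtain ⟨i, hi, -⟩ := hcov L h le_rfl
    rw [Finset.card_eq_zero.1 hm] at hi
    simp at hi
  | succ m ih =>
    rcases le_or_gt L R with h | h
    · exact .done h
    -- Take a point so close to `R` from the right that no sensor starting strictly beyond `R`
    -- contains it. Whatever covers this point starts at or before `R`.
    have hex : ∃ i ∈ U, y i - r i ≤ R ∧ R < y i + r i := by
      have h1 : ∀ᶠ p in nhdsWithin R (Set.Ioi R), p ≤ L :=
        (Ioc_mem_nhdsGT h |> Filter.mem_of_superset) fun p hp => hp.2
      have h2 : ∀ᶠ p in nhdsWithin R (Set.Ioi R), ∀ i ∈ U, R < y i - r i → p < y i - r i := by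
        rw [Filter.eventually_all_finset]
        intro i _
        by_cases hi : R < y i - r i
        · exact Filter.mem_of_superset (Ioo_mem_nhdsGT hi) fun p hp _ => hp.2
        · exact Filter.Eventually.of_forall fun p h => absurd h hi
      obtain ⟨p, ⟨hp1, hp2⟩, hp3⟩ := ((h1.and h2).and self_mem_nhdsWithin).exists
      obtain ⟨i, hi, hpi⟩ := hcov p hp3 hp1
      refine ⟨i, hi, ?_, lt_of_lt_of_le hp3 hpi.2⟩
      by_contra hcon
      exact absurd hpi.1 (not_le.2 (hp2 i hi (not_le.1 hcon)))
    obtain ⟨i, hi, hi1, hi2⟩ := hex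
    have hmi := abs_le.1 (hmove i)
    have hadv : y i + r i ≤ advance x r lam R i :=
      (le_min (by linarith) (by linarith)).trans (le_max_right _ _)
    refine .move i hi (by linarith) (ih ?_ ?_)
    · intro p hp hpL
      obtain ⟨i', hi', hpi'⟩ := hcov p ((le_advance R i).trans_lt hp) hpL
      refine ⟨i', Finset.mem_erase.2 ⟨?_, hi'⟩, hpi'⟩
      rintro rfl
      linarith [hpi'.2]
    · rw [Finset.card_erase_of_mem hi]
      omega

theorem Input.Feasible.feas {n : ℕ} {I : Input n} {lam : ℝ} (h : I.Feasible lam) :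
    Feas I.x I.r lam I.L Finset.univ 0 := by
  obtain ⟨y, hy, hm⟩ := h
  refine feas_of_cover hm fun p hp hpL => ?_
  obtain ⟨i, hi⟩ := hy p ⟨hp.le, hpL⟩
  exact ⟨i, Finset.mem_univ i, hi⟩

/-- `rb` ranks the sensors by deadline and `ra` by release. -/
structure Ranking {n : ℕ} (I : Input n) where
  rb : Equiv.Perm (Fin n)
  ra : Equiv.Perm (Fin n)
  deadline_mono : ∀ i j, rb i ≤ rb j → I.x i + I.r i ≤ I.x j + I.r j
  release_mono : ∀ i j, ra i ≤ ra j → I.x i - I.r i ≤ I.x j - I.r j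

/-- A configuration of the greedy algorithm: `k` sensors were released, those in `Q` are waiting,
the covered part of the barrier ends at `c + s * lam`, and sensor `i` is at `yc i + ys i * lam`. -/
@[ext]
structure Conf (n : ℕ) where
  k : ℕ
  Q : Finset (Fin n)
  c : ℝ
  s : ℝ
  yc : Fin n → ℝ
  ys : Fin n → ℝ

section Machine

variable {n : ℕ} {I : Input n} (O : Ranking I) (Θ : ℝ → Prop)

/-- The waiting sensor with the earliest deadline. -/
noncomputable def Ranking.front {Q : Finset (Fin n)} (h : Q.Nonempty) : Fin n :=
  (Q.exists_min_image O.rb h).choose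

variable {O} in
theorem Ranking.front_mem {Q : Finset (Fin n)} (h : Q.Nonempty) : O.front h ∈ Q :=
  (Q.exists_min_image O.rb h).choose_spec.1

variable {O} in
theorem Ranking.front_le {Q : Finset (Fin n)} (h : Q.Nonempty) {i : Fin n} (hi : i ∈ Q) :
    O.rb (O.front h) ≤ O.rb i :=
  (Q.exists_min_image O.rb h).choose_spec.2 i hi

/-- The threshold for the release of sensor `i`. -/
noncomputable def Conf.releaseAt (I : Input n) (σ : Conf n) (i : Fin n) : ℝ :=
  (I.x i - I.r i - σ.c) / (1 + σ.s)

/-- The threshold from which on sensor `i` fits completely before its deadline. -/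
noncomputable def Conf.fitAt (I : Input n) (σ : Conf n) (i : Fin n) : ℝ :=
  σ.c + 2 * I.r i - (I.x i + I.r i)

/-- The threshold from which on the deadline of sensor `i` has not passed. -/
noncomputable def Conf.liveAt (I : Input n) (σ : Conf n) (i : Fin n) : ℝ :=
  σ.c - (I.x i + I.r i)

/-- The next sensor is released. -/
def Conf.CanRelease (σ : Conf n) : Prop :=
  ∃ h : σ.k < n, Θ (σ.releaseAt I (O.ra.symm ⟨σ.k, h⟩))

/-- The test whether `q` is at most the parameter, or at most `0` if the slope is positive. -/
def Conf.Test (σ : Conf n) (q : ℝ) : Prop :=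
  (σ.s ≤ 0 ∧ Θ q) ∨ (¬ σ.s ≤ 0 ∧ q ≤ 0)

open Classical in
/-- Place the waiting sensor `j`. -/
noncomputable def Conf.place (I : Input n) (σ : Conf n) (j : Fin n) : Conf n :=
  if σ.Test Θ (σ.fitAt I j) then
    { k := σ.k, Q := σ.Q.erase j, c := σ.c + 2 * I.r j, s := σ.s,
      yc := Function.update σ.yc j (σ.c + I.r j), ys := Function.update σ.ys j σ.s }
  else if σ.Test Θ (σ.liveAt I j) then
    { k := σ.k, Q := σ.Q.erase j, c := I.x j + I.r j, s := 1,
      yc := Function.update σ.yc j (I.x j), ys := Function.update σ.ys j 1 }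
  else { σ with Q := σ.Q.erase j }

open Classical in
/-- One step of the greedy algorithm.  `Θ q` tells whether `q` is at most the parameter. -/
noncomputable def Conf.step (σ : Conf n) : Conf n :=
  if h : σ.CanRelease O Θ then
    { σ with k := σ.k + 1, Q := insert (O.ra.symm ⟨σ.k, h.1⟩) σ.Q }
  else if h : σ.Q.Nonempty then σ.place Θ I (O.front h)
  else σ

/-- The initial configuration. -/
def Conf.start (I : Input n) : Conf n where
  k := 0
  Q := ∅
  c := 0
  s := 0
  yc := I.x
  ys := 0

/-- The comparisons made in one step. -/
def Conf.asked (σ : Conf n) : Set ℝ :=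
  {q | (∃ h : σ.k < n, q = σ.releaseAt I (O.ra.symm ⟨σ.k, h⟩)) ∨
    ∃ h : σ.Q.Nonempty, q = σ.fitAt I (O.front h) ∨ q = σ.liveAt I (O.front h)}

variable {O Θ}

theorem Conf.step_congr {Θ' : ℝ → Prop} {σ : Conf n} (h : ∀ q ∈ σ.asked O, (Θ q ↔ Θ' q)) :
    σ.step O Θ = σ.step O Θ' := by
  have h1 : σ.CanRelease O Θ ↔ σ.CanRelease O Θ' :=
    exists_congr fun hk => h _ (Or.inl ⟨hk, rfl⟩)
  have h2 : ∀ hQ : σ.Q.Nonempty, σ.place Θ I (O.front hQ) = σ.place Θ' I (O.front hQ) := by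
    intro hQ
    have ha := h _ (Or.inr ⟨hQ, Or.inl rfl⟩)
    have hb := h _ (Or.inr ⟨hQ, Or.inr rfl⟩)
    have hfit : σ.Test Θ (σ.fitAt I (O.front hQ)) ↔ σ.Test Θ' (σ.fitAt I (O.front hQ)) := by
      simp only [Conf.Test, ha]
    have hlive : σ.Test Θ (σ.liveAt I (O.front hQ)) ↔ σ.Test Θ' (σ.liveAt I (O.front hQ)) := by
      simp only [Conf.Test, hb]
    unfold Conf.place
    by_cases h1 : σ.Test Θ (σ.fitAt I (O.front hQ))
    · rw [if_pos h1, if_pos (hfit.1 h1)]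
    · rw [if_neg h1, if_neg fun h => h1 (hfit.2 h)]
      by_cases h2 : σ.Test Θ (σ.liveAt I (O.front hQ))
      · rw [if_pos h2, if_pos (hlive.1 h2)]
      · rw [if_neg h2, if_neg fun h => h2 (hlive.2 h)]
  unfold Conf.step
  by_cases hc : σ.CanRelease O Θ
  · rw [dif_pos hc, dif_pos (h1.1 hc)]
  · rw [dif_neg hc, dif_neg fun h => hc (h1.2 h)]
    by_cases hQ : σ.Q.Nonempty
    · rw [dif_pos hQ, dif_pos hQ, h2 hQ]
    · rw [dif_neg hQ, dif_neg hQ]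

/-- The parameter enters a run only through the comparisons made. This is what allows a run with an
unknown parameter. -/
theorem Conf.iterate_congr {Θ' : ℝ → Prop} {σ : Conf n} {m : ℕ}
    (h : ∀ t < m, ∀ q ∈ ((Conf.step O Θ)^[t] σ).asked O, (Θ q ↔ Θ' q)) :
    (Conf.step O Θ)^[m] σ = (Conf.step O Θ')^[m] σ := by
  induction m with
  | zero => rfl
  | succ m ih =>
    rw [Function.iterate_succ_apply', Function.iterate_succ_apply',
      ← ih fun t ht => h t (by omega), Conf.step_congr (h m (by omega))]

/-- Nothing more happens. -/
def Conf.Idle (O : Ranking I) (Θ : ℝ → Prop) (σ : Conf n) : Prop :=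
  ¬ σ.CanRelease O Θ ∧ σ.Q = ∅

theorem Conf.place_Q (σ : Conf n) (j : Fin n) : (σ.place Θ I j).Q = σ.Q.erase j := by
  unfold Conf.place
  split_ifs <;> rfl

theorem Conf.place_k (σ : Conf n) (j : Fin n) : (σ.place Θ I j).k = σ.k := by
  unfold Conf.place
  split_ifs <;> rfl

/-- Each sensor causes two events, its release and its placement, so an unreleased sensor has
potential 2 and a waiting one potential 1. -/
theorem Conf.step_measure (σ : Conf n) : σ.Idle O Θ ∨
    2 * (n - (σ.step O Θ).k) + (σ.step O Θ).Q.card + 1 ≤ 2 * (n - σ.k) + σ.Q.card := by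
  unfold Conf.step
  by_cases hc : σ.CanRelease O Θ
  · right
    rw [dif_pos hc]
    obtain ⟨hk, -⟩ := hc
    have := Finset.card_insert_le (O.ra.symm ⟨σ.k, hk⟩) σ.Q
    simp only
    omega
  · rw [dif_neg hc]
    by_cases hQ : σ.Q.Nonempty
    · right
      rw [dif_pos hQ, Conf.place_Q, Conf.place_k, Finset.card_erase_of_mem (O.front_mem hQ)]
      have := hQ.card_pos
      omega
    · exact Or.inl ⟨hc, Finset.not_nonempty_iff_eq_empty.1 hQ⟩

theorem Conf.Idle.step_eq {σ : Conf n} (h : σ.Idle O Θ) : σ.step O Θ = σ := by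
  unfold Conf.step
  rw [dif_neg h.1, dif_neg (by simp [h.2])]

theorem Conf.idle_iterate : ((Conf.step O Θ)^[2 * n] (Conf.start I)).Idle O Θ := by
  have key : ∀ t, ((Conf.step O Θ)^[t] (Conf.start I)).Idle O Θ ∨
      2 * (n - ((Conf.step O Θ)^[t] (Conf.start I)).k) +
        ((Conf.step O Θ)^[t] (Conf.start I)).Q.card + t ≤ 2 * n := by
    intro t
    induction t with
    | zero => right; simp [Conf.start]
    | succ t ih =>
      rw [Function.iterate_succ_apply']
      rcases ih with ih | ih
      · left; rwa [ih.step_eq]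
      · rcases Conf.step_measure (O := O) (Θ := Θ) ((Conf.step O Θ)^[t] (Conf.start I))
          with h | h
        · left; rwa [h.step_eq]
        · right; omega
  rcases key (2 * n) with h | h
  · exact h
  · refine ⟨fun ⟨hk, _⟩ => by omega, Finset.card_eq_zero.1 (by omega)⟩

/-- The sensors that were not placed yet. -/
def Conf.left (O : Ranking I) (σ : Conf n) : Finset (Fin n) :=
  σ.Q ∪ Finset.univ.filter fun i => σ.k ≤ (O.ra i).val

/-- The end of the covered part. -/
def Conf.val (lam : ℝ) (σ : Conf n) : ℝ := σ.c + σ.s * lam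

/-- The position of a sensor. -/
def Conf.pos (lam : ℝ) (σ : Conf n) (i : Fin n) : ℝ := σ.yc i + σ.ys i * lam

/-- The invariant of the greedy algorithm with parameter `lam`. -/
structure Conf.Good (O : Ranking I) (lam : ℝ) (σ : Conf n) : Prop where
  slope : σ.s = 0 ∨ σ.s = 1
  nonneg : 0 ≤ σ.val lam
  waiting : ∀ i ∈ σ.Q, (O.ra i).val < σ.k ∧ I.x i - I.r i - lam ≤ σ.val lam
  covers : 0 < σ.val lam → ∀ p, 0 ≤ p → p ≤ σ.val lam →
    ∃ i, i ∉ σ.left O ∧ p ∈ Set.Icc (σ.pos lam i - I.r i) (σ.pos lam i + I.r i)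
  move : ∀ i, |I.x i - σ.pos lam i| ≤ lam
  feas : Feas I.x I.r lam I.L Finset.univ 0 → Feas I.x I.r lam I.L (σ.left O) (σ.val lam)

variable {lam : ℝ}

theorem Conf.Good.releaseAt_le {σ : Conf n} (h : σ.Good O lam) (i : Fin n) :
    σ.releaseAt I i ≤ lam ↔ I.x i - I.r i - lam ≤ σ.val lam := by
  have : 0 < 1 + σ.s := by rcases h.slope with h | h <;> rw [h] <;> norm_num
  rw [Conf.releaseAt, div_le_iff₀ this, Conf.val]
  constructor <;> intro h <;> linarith

theorem Conf.start_good (hlam : 0 ≤ lam) : (Conf.start I).Good O lam where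
  slope := Or.inl rfl
  nonneg := by simp [Conf.val, Conf.start]
  waiting := by simp [Conf.start]
  covers := by simp [Conf.val, Conf.start]
  move := by simp [Conf.pos, Conf.start, hlam]
  feas := by
    intro h
    refine h.mono ?_ ?_
    · intro i; simp [Conf.left, Conf.start]
    · simp [Conf.val, Conf.start]

/-- The three outcomes of a placement realize the three cases of `advance`: full length, cut off at
the deadline, and too late, in which case the sensor stays where it is. -/
theorem Conf.Good.place {σ : Conf n} (h : σ.Good O lam) (j : Fin n)
    (hj : I.x j - I.r j - lam ≤ σ.val lam) :
    ((σ.place (· ≤ lam) I j).s = 0 ∨ (σ.place (· ≤ lam) I j).s = 1) ∧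
    (σ.place (· ≤ lam) I j).val lam = advance I.x I.r lam (σ.val lam) j ∧
    (∀ i, i ≠ j → (σ.place (· ≤ lam) I j).pos lam i = σ.pos lam i) ∧
    |I.x j - (σ.place (· ≤ lam) I j).pos lam j| ≤ lam ∧
    (σ.val lam < (σ.place (· ≤ lam) I j).val lam →
      (σ.place (· ≤ lam) I j).pos lam j - I.r j ≤ σ.val lam ∧
      (σ.place (· ≤ lam) I j).pos lam j + I.r j = (σ.place (· ≤ lam) I j).val lam) := by
  have hr := I.r_pos j
  have hlam : 0 ≤ lam := (abs_nonneg _).trans (h.move j)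
  -- With slope 1 the parameter cancels between the covered end and the deadline, so the threshold
  -- is compared with 0; with slope 0 it is compared with `lam`.
  have hfit : σ.Test (· ≤ lam) (σ.fitAt I j) ↔
      σ.val lam + 2 * I.r j ≤ I.x j + I.r j + lam := by
    rcases h.slope with hs | hs <;> simp only [Conf.Test, Conf.fitAt, Conf.val, hs] <;> norm_num <;>
      constructor <;> intro h <;> linarith
  have hlive : σ.Test (· ≤ lam) (σ.liveAt I j) ↔
      σ.val lam ≤ I.x j + I.r j + lam := by
    rcases h.slope with hs | hs <;> simp only [Conf.Test, Conf.liveAt, Conf.val, hs] <;> norm_num <;>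
      constructor <;> intro h <;> linarith
  unfold Conf.place
  simp only [hfit, hlive]
  by_cases h1 : σ.val lam + 2 * I.r j ≤ I.x j + I.r j + lam
  · simp only [if_pos h1]
    refine ⟨h.slope, ?_, ?_, ?_, ?_⟩
    · rw [advance, min_eq_left h1, max_eq_right (by linarith)]
      simp only [Conf.val]
      ring
    · intro i hi
      simp [Conf.pos, hi]
    · simp only [Conf.pos, Function.update_self]
      simp only [Conf.val] at h1 hj
      rw [abs_le]
      constructor <;> linarith
    · simp only [Conf.pos, Function.update_self, Conf.val]
      intro _
      constructor <;> linarith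
  · simp only [if_neg h1]
    rw [not_le] at h1
    by_cases h2 : σ.val lam ≤ I.x j + I.r j + lam
    · simp only [if_pos h2]
      refine ⟨Or.inr trivial, ?_, ?_, ?_, ?_⟩
      · rw [advance, min_eq_right h1.le, max_eq_right h2]
        simp [Conf.val]
      · intro i hi
        simp [Conf.pos, hi]
      · simp [Conf.pos, abs_of_nonneg hlam]
      · simp only [Conf.pos, Function.update_self]
        intro _
        constructor
        · linarith
        · simp only [Conf.val]; ring
    · simp only [if_neg h2]
      rw [not_le] at h2
      refine ⟨h.slope, ?_, fun _ _ => rfl, h.move j, fun h => absurd h (lt_irrefl _)⟩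
      rw [advance, max_eq_left ((min_le_right _ _).trans h2.le)]
      rfl

/-- Coverage is credited only to sensors outside `Conf.left`, whose positions are final. Feasibility
of the remaining problem survives a placement by `Feas.earliest_deadline`. -/
theorem Conf.Good.step {σ : Conf n} (h : σ.Good O lam) : (σ.step O (· ≤ lam)).Good O lam := by
  have hlam : 0 ≤ lam := (abs_nonneg _).trans (h.move ⟨0, I.pos⟩)
  unfold Conf.step
  by_cases hc : σ.CanRelease O (· ≤ lam)
  · rw [dif_pos hc]
    obtain ⟨hk, hrel⟩ := hc
    have hleft : Conf.left O { σ with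
        k := σ.k + 1, Q := insert (O.ra.symm ⟨σ.k, hk⟩) σ.Q } = σ.left O := by
      ext i
      have : i = O.ra.symm ⟨σ.k, hk⟩ ↔ (O.ra i).val = σ.k := by
        rw [Equiv.eq_symm_apply, Fin.ext_iff]
      simp only [Conf.left, Finset.mem_union, Finset.mem_insert, Finset.mem_filter,
        Finset.mem_univ, true_and, this]
      constructor
      · rintro ((h | h) | h)
        · right; omega
        · exact Or.inl h
        · right; omega
      · rintro (h | h)
        · exact Or.inl (Or.inr h)
        · rcases h.eq_or_lt with h | h
          · exact Or.inl (Or.inl h.symm)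
          · exact Or.inr h
    refine ⟨h.slope, h.nonneg, ?_, ?_, h.move, ?_⟩
    · intro i hi
      rcases Finset.mem_insert.1 hi with rfl | hi
      · exact ⟨by simp, (h.releaseAt_le _).1 hrel⟩
      · exact ⟨(h.waiting i hi).1.trans (Nat.lt_succ_self _), (h.waiting i hi).2⟩
    · rw [hleft]; exact h.covers
    · rw [hleft]; exact h.feas
  · rw [dif_neg hc]
    by_cases hQ : σ.Q.Nonempty
    · rw [dif_pos hQ]
      have hj := O.front_mem hQ
      have hmin : ∀ i ∈ σ.Q, O.rb (O.front hQ) ≤ O.rb i := fun i hi => O.front_le hQ hi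
      generalize O.front hQ = j at hj hmin
      obtain ⟨hs, hval, hpos, hmv, hcov⟩ := h.place j (h.waiting j hj).2
      have hadv := le_advance (x := I.x) (r := I.r) (lam := lam) (σ.val lam) j
      have hleft : (σ.place (· ≤ lam) I j).left O = (σ.left O).erase j := by
        ext i
        have := (h.waiting j hj).1
        simp only [Conf.left, Conf.place_Q, Conf.place_k, Finset.mem_union, Finset.mem_erase,
          Finset.mem_filter, Finset.mem_univ, true_and]
        constructor
        · rintro (h | h)
          · exact ⟨h.1, Or.inl h.2⟩
          · exact ⟨by rintro rfl; omega, Or.inr h⟩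
        · rintro ⟨h, h' | h'⟩
          · exact Or.inl ⟨h, h'⟩
          · exact Or.inr h'
      have hjl : j ∈ σ.left O := Finset.mem_union_left _ hj
      refine ⟨hs, ?_, ?_, ?_, ?_, ?_⟩
      · rw [hval]; exact h.nonneg.trans hadv
      · intro i hi
        rw [Conf.place_Q] at hi
        have := h.waiting i (Finset.mem_of_mem_erase hi)
        rw [Conf.place_k, hval]
        exact ⟨this.1, this.2.trans hadv⟩
      · intro h0 p hp0 hp
        rw [hleft]
        by_cases hpR : 0 < σ.val lam ∧ p ≤ σ.val lam
        · obtain ⟨i, hi, hpi⟩ := h.covers hpR.1 p hp0 hpR.2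
          refine ⟨i, fun h => hi (Finset.mem_of_mem_erase h), ?_⟩
          rw [hpos i (by rintro rfl; exact hi hjl)]
          exact hpi
        · have hlt : σ.val lam < (σ.place (· ≤ lam) I j).val lam := by
            by_contra hcon
            exact hpR ⟨h0.trans_le (not_lt.1 hcon), hp.trans (not_lt.1 hcon)⟩
          obtain ⟨h1, h2⟩ := hcov hlt
          refine ⟨j, Finset.notMem_erase j _, ?_, by rw [h2]; exact hp⟩
          refine h1.trans ?_
          by_contra hcon
          rw [not_le] at hcon
          exact hpR ⟨hp0.trans_lt hcon, hcon.le⟩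
      · intro i
        by_cases hij : i = j
        · subst hij; exact hmv
        · rw [hpos i hij]; exact h.move i
      · intro hF
        rw [hleft, hval]
        refine (h.feas hF).earliest_deadline (key := fun i => (O.rb i).val) hlam I.r_pos
          (fun i i' hii' => O.deadline_mono i i' hii')
          (Fin.val_injective.comp O.rb.injective) hjl (h.waiting j hj).2 ?_
        -- No waiting sensor precedes the front. Every unreleased one is released no earlier than
        -- the next in release order, whose test has just failed.
        intro i hi hlt
        rcases Finset.mem_union.1 hi with hi | hi
        · exact absurd (hmin i hi) (not_le.2 hlt)
        · simp only [Finset.mem_filter, Finset.mem_univ, true_and] at hi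
          have hk : σ.k < n := hi.trans_lt (O.ra i).isLt
          have h1 : ¬ σ.releaseAt I (O.ra.symm ⟨σ.k, hk⟩) ≤ lam := fun h => hc ⟨hk, h⟩
          rw [h.releaseAt_le, not_le] at h1
          have := O.release_mono (O.ra.symm ⟨σ.k, hk⟩) i (by simpa [Fin.le_def] using hi)
          linarith
    · rw [dif_neg hQ]; exact h

/-- The final configuration of the greedy algorithm with parameter `lam`. -/
noncomputable def Ranking.final (O : Ranking I) (Θ : ℝ → Prop) : Conf n :=
  (Conf.step O Θ)^[2 * n] (Conf.start I)

theorem Ranking.final_good (O : Ranking I) (hlam : 0 ≤ lam) :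
    (O.final (· ≤ lam)).Good O lam := by
  have : ∀ t, ((Conf.step O (· ≤ lam))^[t] (Conf.start I)).Good O lam := by
    intro t
    induction t with
    | zero => exact Conf.start_good hlam
    | succ t ih => rw [Function.iterate_succ_apply']; exact ih.step
  exact this _

theorem Ranking.covers_of_final (O : Ranking I) (hlam : 0 ≤ lam)
    (h : I.L ≤ (O.final (· ≤ lam)).val lam) : I.Covers ((O.final (· ≤ lam)).pos lam) := by
  rintro p ⟨hp0, hpL⟩
  obtain ⟨i, -, hi⟩ := (O.final_good hlam).covers (I.L_pos.trans_le h) p hp0 (hpL.trans h)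
  exact ⟨i, hi⟩

/-- In an idle configuration all remaining sensors are unreleased, so no schedule can continue by a
move. If the remaining problem is feasible, the barrier is already covered. -/
theorem Ranking.le_final_iff (O : Ranking I) (hlam : 0 ≤ lam) :
    I.L ≤ (O.final (· ≤ lam)).val lam ↔ I.Feasible lam := by
  have hg := O.final_good hlam
  refine ⟨fun h => ⟨_, O.covers_of_final hlam h, hg.move⟩, fun h => ?_⟩
  obtain ⟨hr, hQ⟩ : (O.final (· ≤ lam)).Idle O (· ≤ lam) := Conf.idle_iterate
  cases hg.feas h.feas with
  | done h => exact h
  | move i hi hiR _ =>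
    simp only [Conf.left, hQ, Finset.empty_union, Finset.mem_filter, Finset.mem_univ,
      true_and] at hi
    have hk := hi.trans_lt (O.ra i).isLt
    refine absurd ⟨hk, ?_⟩ hr
    refine (hg.releaseAt_le _).2 ?_
    have := O.release_mono (O.ra.symm ⟨_, hk⟩) i (by simpa [Fin.le_def] using hi)
    linarith

end Machine

end BCLS

/-! ### Parametric search: the optimum is among the queries. -/

namespace BCLS

section Optimality

variable {n : ℕ} {I : Input n} (O : Ranking I)

/-- The answers of the decision procedure: `q` is not the length of a feasible move. -/
def Input.Below (I : Input n) (q : ℝ) : Prop := ¬ (0 ≤ q ∧ I.Feasible q)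

/-- If the greedy algorithm is run with the answers of the decision procedure, then one of its
queries is at most the optimum. -/
theorem Ranking.exists_query_le {S : Set ℝ} (hS : S.Finite) (h0 : (0 : ℝ) ∈ S)
    (hasked : ∀ t < 2 * n, ((Conf.step O I.Below)^[t] (Conf.start I)).asked O ⊆ S)
    (hlast : (I.L - (O.final I.Below).c) / (O.final I.Below).s ∈ S)
    {mu : ℝ} (hmu0 : 0 ≤ mu) (hmu : I.Feasible mu) :
    ∃ q ∈ S, 0 ≤ q ∧ I.Feasible q ∧ q ≤ mu := by
  by_contra hcon
  push Not at hcon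
  have hne : (S ∩ {q | 0 ≤ q ∧ ¬ I.Feasible q}).Nonempty :=
    ⟨0, h0, le_rfl, fun h => absurd hmu0 (not_le.2 (hcon 0 h0 le_rfl h))⟩
  -- The query 0 makes this set nonempty: were 0 feasible, it would itself be a feasible query at
  -- most `mu`.
  obtain ⟨lam, ⟨-, hlam0, hlam⟩, hmax⟩ :=
    Set.exists_max_image _ id (hS.inter_of_left _) hne
  have hlt : lam < mu := by
    by_contra h
    exact hlam (hmu.mono (not_lt.1 h))
  -- Feasible nonnegative queries exceed `mu` by assumption and all others are at most `lam`. So the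
  -- oracle answers like the parameter `lam` and also like the parameter `mu`.
  have hq : ∀ q ∈ S, (I.Below q ↔ q ≤ lam) ∧ (I.Below q ↔ q ≤ mu) := by
    intro q hqS
    by_cases hB : 0 ≤ q ∧ I.Feasible q
    · have := hcon q hqS hB.1 hB.2
      simp only [Input.Below, hB, not_true, and_self, false_iff, not_le]
      exact ⟨hlt.trans this, this⟩
    · have : q ≤ lam := by
        rcases lt_or_ge q 0 with h | h
        · exact h.le.trans hlam0
        · exact hmax q ⟨hqS, h, fun hf => hB ⟨h, hf⟩⟩
      simp only [Input.Below, hB, not_false_iff, true_iff]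
      exact ⟨this, this.trans hlt.le⟩
  have e1 : O.final I.Below = O.final (· ≤ lam) :=
    Conf.iterate_congr fun t ht q h => (hq q (hasked t ht h)).1
  have e2 : O.final I.Below = O.final (· ≤ mu) :=
    Conf.iterate_congr fun t ht q h => (hq q (hasked t ht h)).2
  have h1 := (not_congr (O.le_final_iff hlam0)).2 hlam
  have h2 := (O.le_final_iff hmu0).2 hmu
  have h3 := (O.final_good hlam0).slope
  rw [← e1] at h1 h3
  rw [← e2] at h2
  have h4 := hq _ hlast
  simp only [Conf.val] at h1 h2
  -- Slope 0 gives the same end for both parameters. With slope 1 the last query is `L - c`, which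
  -- would lie above `lam` and at most at `mu`.
  rcases h3 with h3 | h3 <;> rw [h3] at h1 h2 h4
  · simp only [zero_mul] at h1 h2
    exact h1 h2
  · simp only [div_one] at h4
    have := h4.1.1 (h4.2.2 (by linarith))
    exact h1 (by linarith)

end Optimality

end BCLS

/-! ### A priority queue: counters in a complete binary tree stored as a heap-indexed array. -/

namespace RealRAM

/-- In the binary tree with root `1` and children `2 * q`, `2 * q + 1` of `q`, the node `q` is `p`
or an ancestor of `p`. -/
def IsAnc (q p : ℕ) : Prop := ∃ e, p / 2 ^ e = q

theorem isAnc_self (p : ℕ) : IsAnc p p := ⟨0, by simp⟩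

theorem IsAnc.half {q p : ℕ} (h : IsAnc q p) : IsAnc (q / 2) p := by
  obtain ⟨e, rfl⟩ := h
  exact ⟨e + 1, by rw [Nat.pow_succ, Nat.div_div_eq_div_mul]⟩

theorem IsAnc.le {q p : ℕ} (h : IsAnc q p) : q ≤ p := by
  obtain ⟨e, rfl⟩ := h
  exact Nat.div_le_self _ _

theorem isAnc_iff {q p : ℕ} : IsAnc q p ↔ q = p ∨ IsAnc q (p / 2) := by
  constructor
  · rintro ⟨e, he⟩
    cases e with
    | zero => left; simpa using he.symm
    | succ e =>
      right
      exact ⟨e, by rw [← he, Nat.div_div_eq_div_mul, Nat.pow_succ, Nat.mul_comm]⟩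
  · rintro (rfl | ⟨e, he⟩)
    · exact isAnc_self _
    · exact ⟨e + 1, by rw [← he, Nat.div_div_eq_div_mul, Nat.pow_succ, Nat.mul_comm]⟩

/-- The first two hypotheses say that all leaves under `p` at depth `k` lie in the leaf level. Sizes
then exclude any other distance between `p` and a leaf. -/
theorem exponent_eq {N p k u e : ℕ} (h1 : N ≤ p * 2 ^ k) (h2 : (p + 1) * 2 ^ k ≤ 2 * N)
    (hu1 : N ≤ u) (hu2 : u < 2 * N) (he : u / 2 ^ e = p) : e = k := by
  have h3 : p * 2 ^ e ≤ u := he ▸ Nat.div_mul_le_self u _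
  have h4 : u < (p + 1) * 2 ^ e := by
    rw [← he]
    exact (Nat.div_lt_iff_lt_mul (Nat.two_pow_pos e)).1 (Nat.lt_succ_self _)
  rcases lt_trichotomy e k with h | h | h
  · have : 2 ^ e * 2 ≤ 2 ^ k := by
      rw [← Nat.pow_succ]; exact Nat.pow_le_pow_right (by norm_num) h
    have : (p + 1) * (2 ^ e * 2) ≤ (p + 1) * 2 ^ k := Nat.mul_le_mul_left _ this
    nlinarith
  · exact h
  · have : 2 ^ k * 2 ≤ 2 ^ e := by
      rw [← Nat.pow_succ]; exact Nat.pow_le_pow_right (by norm_num) h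
    have : p * (2 ^ k * 2) ≤ p * 2 ^ e := Nat.mul_le_mul_left _ this
    nlinarith

/-- Change the entries `T[q]` for all ancestors `q` of the node in the variable `p`. -/
def climb (T p : ℕ) (e : NExpr → NExpr) : Prog :=
  .loop (.natLe (.const 1) (.var p))
    (.seq (.setNat T (.var p) (e (.get T (.var p)))) (.setNat p (.const 0) (.half (.var p))))

/-- A bound for the running time of `climb`. -/
def climbCost (T p : ℕ) (e : NExpr → NExpr) (h : ℕ) : ℕ :=
  h * ((Test.natLe (.const 1) (.var p)).cost +
    (Prog.seq (.setNat T (.var p) (e (.get T (.var p))))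
      (.setNat p (.const 0) (.half (.var p)))).cost) + (Test.natLe (.const 1) (.var p)).cost

open Classical in
-- The restriction to `1 ≤ q` matters: `IsAnc 0 p` always holds, but the loop stops before it would
-- touch cell 0.
theorem WP.climb {T p h : ℕ} (hTp : T ≠ p) {e : NExpr → NExpr} {g : ℕ → ℕ}
    (he : ∀ s x, (e x).eval s = g (x.eval s)) {s : State} (hp : s.nat p 0 < 2 ^ h) :
    WP (climb T p e) (climbCost T p e h) (fun s' => ∀ q, 1 ≤ q →
      s'.nat T q = if IsAnc q (s.nat p 0) then g (s.nat T q) else s.nat T q) s := by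
  -- The entries already changed are those of the ancestors of the leaf that are not ancestors of
  -- the current node.
  refine (WP.loop (fun k s' => s'.nat p 0 < 2 ^ k ∧ IsAnc (s'.nat p 0) (s.nat p 0) ∧
    ∀ q, 1 ≤ q → s'.nat T q = if IsAnc q (s.nat p 0) ∧ ¬ IsAnc q (s'.nat p 0)
      then g (s.nat T q) else s.nat T q) ?_ ?_ (k := h) ?_).mono le_rfl ?_
  · rintro s' ⟨h1, -, -⟩ h2
    simp only [Test.Holds, NExpr.eval] at h2
    omega
  · rintro k s' ⟨h1, h2, h3⟩ hb
    simp only [Test.Holds, NExpr.eval] at hb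
    refine WP.block (by simp [Prog.LoopFree]) ?_
    have hpT : p ≠ T := hTp.symm
    simp only [Prog.exec, NExpr.eval, State.nat_writeNat, he, hTp, hpT, false_and, if_false,
      true_and, if_true]
    refine ⟨by rw [Nat.pow_succ] at h1; omega, h2.half, fun q hq => ?_⟩
    by_cases hqp : q = s'.nat p 0
    · have hn : ¬ IsAnc q (s'.nat p 0 / 2) := fun h => by have := h.le; omega
      have h4 := h3 q hq
      rw [if_neg (by rw [hqp]; exact fun h => h.2 (isAnc_self _))] at h4
      rw [if_pos hqp, if_pos ⟨hqp ▸ h2, hn⟩, ← hqp, h4]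
    · rw [if_neg hqp, h3 q hq]
      have : IsAnc q (s'.nat p 0) ↔ IsAnc q (s'.nat p 0 / 2) := by
        rw [isAnc_iff]; simp [hqp]
      simp only [this]
  · refine ⟨hp, isAnc_self _, fun q _ => ?_⟩
    rw [if_neg]
    tauto
  · rintro s' ⟨⟨k, h1, h2, h3⟩, hb⟩ q hq
    simp only [Test.Holds, NExpr.eval] at hb
    have h0 : s'.nat p 0 = 0 := by omega
    have hn : ¬ IsAnc q (s'.nat p 0) := fun h => by have := h.le; omega
    rw [h3 q hq]
    simp only [hn, not_false_iff, and_true]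

/-- Go down from the root to the leftmost leaf with a nonzero entry. -/
def descend (T p N : ℕ) : Prog :=
  .seq (.setNat p (.const 0) (.const 1))
    (.loop (.natLt (.var p) (.var N))
      (.seq (.setNat p (.const 0) (.add (.var p) (.var p)))
        (.cond (.natLe (.get T (.var p)) (.const 0))
          (.setNat p (.const 0) (.add (.var p) (.const 1))) .skip)))

/-- A bound for the running time of `descend`. -/
def descendCost (h : ℕ) : ℕ := 3 + (h * (5 + 19) + 5)

/-- `T[q]` is the number of elements of `A` below the node `q`. -/
def CountsTree (N : ℕ) (A : Finset ℕ) (T : ℕ → ℕ) : Prop :=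
  ∀ q, 1 ≤ q → q < 2 * N →
    haveI := Classical.dec
    T q = (A.filter fun u => IsAnc q (N + u)).card

/-- Termination and running time are also needed for the empty set, where the node reached means
nothing; only the result is conditional on `A.Nonempty`. -/
theorem WP.descend {T p N h : ℕ} (hTp : T ≠ p) (hNp : N ≠ p) {A : Finset ℕ} {s : State}
    (hN : s.nat N 0 = 2 ^ h) (hA : ∀ u ∈ A, u < 2 ^ h) (hT : CountsTree (2 ^ h) A (s.nat T)) :
    WP (descend T p N) (descendCost h)
      (fun s' => ∀ hne : A.Nonempty, s'.nat p 0 = 2 ^ h + A.min' hne) s := by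
  classical
  have hpT : p ≠ T := hTp.symm
  have hpN : p ≠ N := hNp.symm
  refine WP.seq (WP.block (by simp [Prog.LoopFree]) ?_)
  -- The fuel `k` is the height of the current node above the leaves, and the least element lies
  -- below this node.
  refine ((WP.loop (B := 19) (fun k s' => s'.nat N 0 = 2 ^ h ∧ s'.nat T = s.nat T ∧
    2 ^ h ≤ s'.nat p 0 * 2 ^ k ∧ (s'.nat p 0 + 1) * 2 ^ k ≤ 2 * 2 ^ h ∧
    ∀ hne : A.Nonempty, (2 ^ h + A.min' hne) / 2 ^ k = s'.nat p 0) ?_ ?_ (k := h) ?_).mono ?_ ?_)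
  · rintro s' ⟨h1, -, h2, -⟩ hb
    simp only [Test.Holds, NExpr.eval] at hb
    omega
  · rintro k s' ⟨h1, h2, h3, h4, h5⟩ hb
    simp only [Test.Holds, NExpr.eval] at hb
    have hp0 : 1 ≤ s'.nat p 0 := by
      rcases Nat.eq_zero_or_pos (s'.nat p 0) with h0 | h0
      · rw [h0, zero_mul] at h3
        have := Nat.two_pow_pos h
        omega
      · exact h0
    rw [pow_succ] at h3 h4
    have hlt : 2 * s'.nat p 0 < 2 * 2 ^ h := by omega
    have hcount := hT (2 * s'.nat p 0) (by omega) hlt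
    refine (WP.block (P := .seq (.setNat p (.const 0) (.add (.var p) (.var p)))
        (.cond (.natLe (.get T (.var p)) (.const 0))
          (.setNat p (.const 0) (.add (.var p) (.const 1))) .skip))
        ⟨trivial, trivial, trivial⟩ ?_).mono (by simp [Prog.cost, NExpr.cost, Test.cost])
        fun _ h => h
    simp only [Prog.exec, NExpr.eval, Test.Holds, State.nat_writeNat, hTp, false_and, if_false,
      and_self, if_true, h2, ← two_mul]
    have hchild : ∀ hne : A.Nonempty, (2 ^ h + A.min' hne) / 2 ^ k / 2 = s'.nat p 0 := by
      intro hne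
      rw [Nat.div_div_eq_div_mul]
      exact h5 hne
    by_cases h0 : s.nat T (2 * s'.nat p 0) ≤ 0
    · rw [if_pos h0]
      refine ⟨by simpa [State.nat_writeNat, hNp] using h1, ?_, ?_, ?_, ?_⟩
      · funext q; simp [State.nat_writeNat, hTp, h2]
      · simp only [State.nat_writeNat, and_self, if_true]
        nlinarith [Nat.two_pow_pos k]
      · simp only [State.nat_writeNat, and_self, if_true]
        nlinarith [Nat.two_pow_pos k]
      · intro hne
        simp only [State.nat_writeNat, and_self, if_true]
        -- The left child counts nothing, so the least element is below the right child.
        have hemp : ¬ (2 ^ h + A.min' hne) / 2 ^ k = 2 * s'.nat p 0 := by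
          intro hcon
          have : 0 < (A.filter fun u => IsAnc (2 * s'.nat p 0) (2 ^ h + u)).card :=
            Finset.card_pos.2 ⟨A.min' hne, Finset.mem_filter.2 ⟨A.min'_mem hne, k, hcon⟩⟩
          rw [← hcount] at this
          omega
        have := hchild hne
        omega
    · rw [if_neg h0]
      refine ⟨by simpa [State.nat_writeNat, hNp] using h1, ?_, ?_, ?_, ?_⟩
      · funext q; simp [State.nat_writeNat, hTp, h2]
      · simp only [State.nat_writeNat, and_self, if_true]
        nlinarith [Nat.two_pow_pos k]
      · simp only [State.nat_writeNat, and_self, if_true]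
        nlinarith [Nat.two_pow_pos k]
      · intro hne
        simp only [State.nat_writeNat, and_self, if_true]
        have hpos : 0 < (A.filter fun u => IsAnc (2 * s'.nat p 0) (2 ^ h + u)).card := by
          rw [← hcount]; omega
        obtain ⟨u, hu⟩ := Finset.card_pos.1 hpos
        obtain ⟨huA, e, he⟩ := Finset.mem_filter.1 hu
        have huh := hA u huA
        -- Some element lies below the left child. The least element is no further to the right, so
        -- it lies there too.
        have hek : e = k := exponent_eq (N := 2 ^ h) (by nlinarith) (by nlinarith)
          (Nat.le_add_right _ _) (by omega) he
        subst hek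
        have hle : (2 ^ h + A.min' hne) / 2 ^ e ≤ 2 * s'.nat p 0 := by
          rw [← he]
          exact Nat.div_le_div_right (Nat.add_le_add_left (A.min'_le u huA) _)
        have := hchild hne
        omega
  · refine ⟨?_, ?_, ?_, ?_, ?_⟩
    · simpa [Prog.exec, State.nat_writeNat, hNp] using hN
    · funext q; simp [Prog.exec, State.nat_writeNat, hTp, NExpr.eval]
    · simp [Prog.exec, State.nat_writeNat, NExpr.eval]
    · simp [Prog.exec, State.nat_writeNat, NExpr.eval]
    · intro hne
      simp only [Prog.exec, State.nat_writeNat, NExpr.eval, and_self, if_true]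
      have := hA _ (A.min'_mem hne)
      rw [Nat.add_div_left _ (Nat.two_pow_pos h), Nat.div_eq_of_lt this]
  · simp [Test.cost, NExpr.cost]
  · rintro s' ⟨⟨k, h1, h2, h3, h4, h5⟩, hb⟩ hne
    simp only [Test.Holds, NExpr.eval, h1, not_lt] at hb
    have hmin := hA _ (A.min'_mem hne)
    have h6 := h5 hne
    cases k with
    | zero => simpa using h6.symm
    | succ k =>
      exfalso
      rw [pow_succ, Nat.mul_comm, ← Nat.div_div_eq_div_mul] at h6
      have h7 : (2 ^ h + A.min' hne) / 2 / 2 ^ k ≤ (2 ^ h + A.min' hne) / 2 := Nat.div_le_self _ _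
      omega

theorem CountsTree.insert {N u : ℕ} {A : Finset ℕ} {T T' : ℕ → ℕ} (h : CountsTree N A T)
    (hu : u ∉ A)
    (hT : ∀ q, 1 ≤ q → haveI := Classical.dec
      T' q = if IsAnc q (N + u) then T q + 1 else T q) :
    CountsTree N (insert u A) T' := by
  classical
  intro q hq1 hq2
  have h1 := h q hq1 hq2
  have h2 := hT q hq1
  rw [Finset.filter_insert]
  by_cases hc : IsAnc q (N + u)
  · rw [if_pos hc] at h2 ⊢
    rw [Finset.card_insert_of_notMem (by simp [hu]), h2, h1]
  · rw [if_neg hc] at h2 ⊢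
    rw [h2, h1]

theorem CountsTree.erase {N u : ℕ} {A : Finset ℕ} {T T' : ℕ → ℕ} (h : CountsTree N A T)
    (hu : u ∈ A)
    (hT : ∀ q, 1 ≤ q → haveI := Classical.dec
      T' q = if IsAnc q (N + u) then T q - 1 else T q) :
    CountsTree N (A.erase u) T' := by
  classical
  intro q hq1 hq2
  have h1 := h q hq1 hq2
  have h2 := hT q hq1
  rw [Finset.filter_erase]
  by_cases hc : IsAnc q (N + u)
  · rw [if_pos hc] at h2
    rw [Finset.card_erase_of_mem (by simp [hu, hc]), h2, h1]
  · rw [if_neg hc] at h2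
    rw [Finset.erase_eq_of_notMem (by simp [hc]), h2, h1]

end RealRAM

/-! ### The greedy algorithm in memory: layout, queries and release of a sensor. -/

namespace BCLS

open RealRAM

section Greedy

variable {n : ℕ} {I : Input n}

/-- The input and the tables computed from it: arrays `1`, `2` and `3` of the natural numbers
contain the inverse of the deadline ranking, the inverse of the release ranking and the deadline
ranking, and array `4` contains the number of leaves of the trees. -/
structure Shared (O : Ranking I) (s : State) : Prop where
  size : s.nat 0 0 = n
  len : s.real 0 0 = I.L
  x : ∀ i : Fin n, s.real 1 i = I.x i
  r : ∀ i : Fin n, s.real 2 i = I.r i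
  pb : ∀ i : Fin n, s.nat 1 (O.rb i) = i
  pa : ∀ i : Fin n, s.nat 2 (O.ra i) = i
  rb : ∀ i : Fin n, s.nat 3 i = O.rb i
  leaves : s.nat 4 0 = 2 ^ Nat.clog 2 n

theorem Shared.congr {O : Ranking I} {s s' : State} (h : Shared O s) {SN SR : Set ℕ}
    (hs : Agree SN SR s s') (hN : ∀ a ∈ SN, 5 ≤ a) (hR : ∀ a ∈ SR, 3 ≤ a) : Shared O s' := by
  have h0 : ∀ a < 5, s'.nat a = s.nat a := fun a ha =>
    hs.1 a fun h => by have := hN a h; omega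
  have h1 : ∀ a < 3, s'.real a = s.real a := fun a ha =>
    hs.2 a fun h => by have := hR a h; omega
  refine ⟨?_, ?_, ?_, ?_, ?_, ?_, ?_, ?_⟩
  · rw [h0 0 (by norm_num)]; exact h.size
  · rw [h1 0 (by norm_num)]; exact h.len
  · rw [h1 1 (by norm_num)]; exact h.x
  · rw [h1 2 (by norm_num)]; exact h.r
  · rw [h0 1 (by norm_num)]; exact h.pb
  · rw [h0 2 (by norm_num)]; exact h.pa
  · rw [h0 3 (by norm_num)]; exact h.rb
  · rw [h0 4 (by norm_num)]; exact h.leaves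

/-- The deadline ranks of a set of sensors. -/
def Ranking.ranks (O : Ranking I) (Q : Finset (Fin n)) : Finset ℕ := Q.image fun i => (O.rb i).val

/-- The memory contains the configuration `σ`, in the arrays with numbers from `m + 20` on. -/
structure Stores (O : Ranking I) (m : ℕ) (σ : Conf n) (s : State) : Prop where
  k : s.nat (m + 21) 0 = σ.k
  c : s.real (m + 20) 0 = σ.c
  slope : s.real (m + 21) 0 = σ.s
  yc : ∀ i : Fin n, s.real (m + 23) i = σ.yc i
  ys : ∀ i : Fin n, s.real (m + 24) i = σ.ys i
  tree : CountsTree (2 ^ Nat.clog 2 n) (O.ranks σ.Q) (s.nat (m + 20))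

theorem Stores.congr {O : Ranking I} {m : ℕ} {σ : Conf n} {s s' : State} (h : Stores O m σ s)
    (h1 : s'.nat (m + 20) = s.nat (m + 20)) (h2 : s'.nat (m + 21) = s.nat (m + 21))
    (h3 : s'.real (m + 20) = s.real (m + 20)) (h4 : s'.real (m + 21) = s.real (m + 21))
    (h5 : s'.real (m + 23) = s.real (m + 23)) (h6 : s'.real (m + 24) = s.real (m + 24)) :
    Stores O m σ s' :=
  ⟨by rw [h2]; exact h.k, by rw [h3]; exact h.c, by rw [h4]; exact h.slope, by rw [h5]; exact h.yc,
    by rw [h6]; exact h.ys, by rw [h1]; exact h.tree⟩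

/-- The numbers of the arrays used by a copy of the greedy algorithm. -/
abbrev Own (m : ℕ) : Set ℕ := Set.Ico (m + 20) (m + 40)

/-- The program `cmp i` puts the answer to the `i`-th query into the `i`-th cell of array
`m + 26`.  The predicate `J S` holds when the queries in `S` were made. -/
structure Comparator (O : Ranking I) (m : ℕ) (cmp : ℕ → Prog) (B : ℕ) (Θ : ℝ → Prop)
    (J : Set ℝ → State → Prop) : Prop where
  run : ∀ (i : ℕ) (S : Set ℝ) (s : State), Shared O s → J S s → WP (cmp i) B (fun s' =>
    Shared O s' ∧ J (insert (s.real (m + 22) i) S) s' ∧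
    (∀ a ∈ Own m, a ≠ m + 26 → s'.nat a = s.nat a) ∧ (∀ a ∈ Own m, s'.real a = s.real a) ∧
    (∀ i', i' ≠ i → s'.nat (m + 26) i' = s.nat (m + 26) i') ∧
    (Θ (s.real (m + 22) i) ∧ s'.nat (m + 26) i = 1 ∨
      ¬ Θ (s.real (m + 22) i) ∧ s'.nat (m + 26) i = 0)) s
  frame : ∀ (S : Set ℝ) (s s' : State), Agree (Own m) (Own m) s s' → J S s → J S s'

/-- Find the waiting sensor with the earliest deadline. -/
def findProg (m : ℕ) : Prog :=
  .seq (descend (m + 20) (m + 23) 4)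
    (.seq (.setNat (m + 24) (.const 0) (.sub (.var (m + 23)) (.var 4)))
      (.setNat (m + 25) (.const 0) (.get 1 (.var (m + 24)))))

theorem Ranking.min'_ranks (O : Ranking I) {Q : Finset (Fin n)} (h : Q.Nonempty)
    (h' : (O.ranks Q).Nonempty) : (O.ranks Q).min' h' = O.rb (O.front h) := by
  apply le_antisymm
  · exact Finset.min'_le _ _ (Finset.mem_image_of_mem _ (O.front_mem h))
  · refine Finset.le_min' _ _ _ fun u hu => ?_
    obtain ⟨i, hi, rfl⟩ := Finset.mem_image.1 hu
    exact O.front_le h hi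

theorem Ranking.lt_of_mem_ranks (O : Ranking I) {Q : Finset (Fin n)} {u : ℕ}
    (h : u ∈ O.ranks Q) : u < 2 ^ Nat.clog 2 n := by
  obtain ⟨i, -, rfl⟩ := Finset.mem_image.1 h
  exact (O.rb i).isLt.trans_le (Nat.le_pow_clog (by norm_num) n)

theorem findProg_spec {O : Ranking I} {m : ℕ} {σ : Conf n} {s : State} (hs : Shared O s)
    (hσ : Stores O m σ s) :
    WP (findProg m) (descendCost (Nat.clog 2 n) + 12)
      (fun s' => (∀ h : σ.Q.Nonempty, s'.nat (m + 24) 0 = O.rb (O.front h) ∧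
        s'.nat (m + 25) 0 = O.front h) ∧ Agree {m + 23, m + 24, m + 25} ∅ s s') s := by
  refine WP.frame ?_ (by simp [findProg, descend, Prog.WritesIn])
  refine WP.seq (((WP.descend (by simp) (by simp) hs.leaves
    (fun u hu => O.lt_of_mem_ranks hu) hσ.tree).frame (SN := {m + 23}) (SR := ∅)
    (by simp [descend, Prog.WritesIn])).mono le_rfl ?_)
  rintro s' ⟨h1, h2⟩
  have hs' := hs.congr h2 (by simp) (by simp)
  refine (WP.block (by simp [Prog.LoopFree]) ?_).mono (by simp [Prog.cost, NExpr.cost])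
    fun _ h => h
  intro h
  have hne : (O.ranks σ.Q).Nonempty := h.image _
  have := h1 hne
  rw [O.min'_ranks h] at this
  have h3 := hs'.pb (O.front h)
  simp [Prog.exec, NExpr.eval, State.nat_writeNat, this, hs'.leaves, h3]

/-- Compute the three thresholds. -/
def thresholdProg (m : ℕ) : Prog :=
  .seq (.setReal (m + 22) (.const 0) (.div (.sub (.sub (.get 1 (.get 2 (.var (m + 21))))
      (.get 2 (.get 2 (.var (m + 21))))) (.var (m + 20))) (.add (.const 1) (.var (m + 21)))))
    (.seq (.setReal (m + 22) (.const 1) (.sub (.add (.var (m + 20))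
        (.mul (.const 2) (.get 2 (.var (m + 25)))))
        (.add (.get 1 (.var (m + 25))) (.get 2 (.var (m + 25))))))
      (.setReal (m + 22) (.const 2) (.sub (.var (m + 20))
        (.add (.get 1 (.var (m + 25))) (.get 2 (.var (m + 25)))))))

theorem thresholdProg_spec {O : Ranking I} {m : ℕ} {σ : Conf n} {s : State} (hs : Shared O s)
    (hσ : Stores O m σ s) (hfront : ∀ h : σ.Q.Nonempty, s.nat (m + 25) 0 = O.front h) :
    WP (thresholdProg m) (thresholdProg m).cost
      (fun s' => ((∀ h : σ.k < n, s'.real (m + 22) 0 = σ.releaseAt I (O.ra.symm ⟨σ.k, h⟩)) ∧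
        ∀ h : σ.Q.Nonempty, s'.real (m + 22) 1 = σ.fitAt I (O.front h) ∧
          s'.real (m + 22) 2 = σ.liveAt I (O.front h)) ∧ Agree ∅ {m + 22} s s') s := by
  refine WP.frame ?_ (by simp [thresholdProg, Prog.WritesIn])
  refine WP.block (by simp [thresholdProg, Prog.LoopFree]) ⟨fun h => ?_, fun h => ?_⟩
  · have h1 := hs.pa (O.ra.symm ⟨σ.k, h⟩)
    simp only [Equiv.apply_symm_apply] at h1
    simp [thresholdProg, Prog.exec, NExpr.eval, RExpr.eval, State.real_writeReal,
      State.nat_writeReal, hσ.k, h1, hs.x, hs.r, hσ.c, hσ.slope, Conf.releaseAt]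
  · simp [thresholdProg, Prog.exec, NExpr.eval, RExpr.eval, State.real_writeReal,
      State.nat_writeReal, hfront h, hs.x, hs.r, hσ.c, Conf.fitAt, Conf.liveAt]

/-- All three queries are made in every step, even if some cells hold meaningless values because no
sensor is waiting or left to release. Superfluous queries only enlarge the recorded set. -/
theorem Comparator.three {O : Ranking I} {m B : ℕ} {cmp : ℕ → Prog} {Θ : ℝ → Prop}
    {J : Set ℝ → State → Prop} (hc : Comparator O m cmp B Θ J) {S : Set ℝ} {s : State}
    (hs : Shared O s) (hJ : J S s) :
    WP (.seq (cmp 0) (.seq (cmp 1) (cmp 2))) (B + (B + B)) (fun s' => Shared O s' ∧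
      J (insert (s.real (m + 22) 2) (insert (s.real (m + 22) 1) (insert (s.real (m + 22) 0) S))) s' ∧
      (∀ a ∈ Own m, a ≠ m + 26 → s'.nat a = s.nat a) ∧ (∀ a ∈ Own m, s'.real a = s.real a) ∧
      ∀ i < 3, (Θ (s.real (m + 22) i) ∧ s'.nat (m + 26) i = 1 ∨
        ¬ Θ (s.real (m + 22) i) ∧ s'.nat (m + 26) i = 0)) s := by
  refine WP.seq ((hc.run 0 S s hs hJ).mono le_rfl ?_)
  rintro s1 ⟨hs1, hJ1, hn1, hr1, hb1, ha1⟩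
  refine WP.seq ((hc.run 1 _ s1 hs1 hJ1).mono le_rfl ?_)
  rintro s2 ⟨hs2, hJ2, hn2, hr2, hb2, ha2⟩
  refine (hc.run 2 _ s2 hs2 hJ2).mono le_rfl ?_
  rintro s3 ⟨hs3, hJ3, hn3, hr3, hb3, ha3⟩
  have hm : m + 22 ∈ Own m := by simp [Own]
  rw [hr1 _ hm] at hJ2 ha2
  rw [hr2 _ hm, hr1 _ hm] at hJ3 ha3
  refine ⟨hs3, hJ3,
    fun a ha h => by rw [hn3 a ha h, hn2 a ha h, hn1 a ha h],
    fun a ha => by rw [hr3 a ha, hr2 a ha, hr1 a ha], fun i hi => ?_⟩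
  interval_cases i
  · rwa [hb3 0 (by norm_num), hb2 0 (by norm_num)]
  · rwa [hb3 1 (by norm_num)]
  · exact ha3

/-- Release the next sensor. -/
def releaseProg (m : ℕ) : Prog :=
  .seq (.setNat (m + 23) (.const 0) (.add (.var 4) (.get 3 (.get 2 (.var (m + 21))))))
    (.seq (climb (m + 20) (m + 23) fun e => .add e (.const 1))
      (.setNat (m + 21) (.const 0) (.add (.var (m + 21)) (.const 1))))

theorem releaseProg_spec {O : Ranking I} {m : ℕ} {σ : Conf n} {s : State} (hs : Shared O s)
    (hσ : Stores O m σ s) (hk : σ.k < n) (hQ : O.ra.symm ⟨σ.k, hk⟩ ∉ σ.Q) :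
    WP (releaseProg m)
      (9 + (climbCost (m + 20) (m + 23) (fun e => .add e (.const 1)) (Nat.clog 2 n + 1) + 6))
      (Stores O m { σ with k := σ.k + 1, Q := insert (O.ra.symm ⟨σ.k, hk⟩) σ.Q }) s := by
  set j := O.ra.symm ⟨σ.k, hk⟩ with hj
  have h1 := hs.pa j
  simp only [hj, Equiv.apply_symm_apply] at h1
  rw [← hj] at h1
  have hjlt : (O.rb j).val < 2 ^ Nat.clog 2 n :=
    (O.rb j).isLt.trans_le (Nat.le_pow_clog (by norm_num) n)
  refine WP.seq ((WP.block (by simp [Prog.LoopFree]) ?_).mono (by simp [Prog.cost, NExpr.cost])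
    fun _ h => h)
  have hp : ((Prog.setNat (m + 23) (.const 0)
      (.add (.var 4) (.get 3 (.get 2 (.var (m + 21)))))).exec s).nat (m + 23) 0 =
      2 ^ Nat.clog 2 n + O.rb j := by
    simp [Prog.exec, NExpr.eval, State.nat_writeNat, hs.leaves, hσ.k, h1, hs.rb]
  refine WP.seq (((WP.climb (g := fun u => u + 1) (by simp) (fun _ _ => rfl)
    (by rw [hp, pow_succ]; omega)).frame (SN := {m + 20, m + 23}) (SR := ∅)
    (by simp [climb, Prog.WritesIn])).mono le_rfl ?_)
  rintro s' ⟨hT, hA⟩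
  rw [hp] at hT
  have hk' : s'.nat (m + 21) 0 = σ.k := by
    rw [hA.1 _ (by simp)]
    simpa [Prog.exec, State.nat_writeNat] using hσ.k
  have hreal : s'.real = s.real := funext fun a => hA.2 a (by simp)
  refine (WP.block (by simp [Prog.LoopFree]) ?_).mono (by simp [Prog.cost, NExpr.cost])
    fun _ h => h
  refine ⟨?_, ?_, ?_, ?_, ?_, ?_⟩
  · simp [Prog.exec, NExpr.eval, State.nat_writeNat, hk']
  · simpa [Prog.exec, State.real_writeNat, hreal] using hσ.c
  · simpa [Prog.exec, State.real_writeNat, hreal] using hσ.slope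
  · simpa [Prog.exec, State.real_writeNat, hreal] using hσ.yc
  · simpa [Prog.exec, State.real_writeNat, hreal] using hσ.ys
  · have hQ' : (O.rb j).val ∉ O.ranks σ.Q := by
      intro h
      obtain ⟨i, hi, hij⟩ := Finset.mem_image.1 h
      rw [O.rb.injective (Fin.val_injective hij)] at hi
      exact hQ hi
    have := hσ.tree.insert hQ' (T' := s'.nat (m + 20)) (fun q hq => by
      rw [hT q hq]; simp [Prog.exec, State.nat_writeNat])
    simpa [Prog.exec, State.nat_writeNat_of_ne, Ranking.ranks, Finset.image_insert] using this

end Greedy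

end BCLS

/-! ### The greedy algorithm in memory: placement and choice of the action. -/

namespace BCLS

open RealRAM

section Greedy

variable {n : ℕ} {I : Input n}

/-- Replace the answers by comparisons with `0` if the slope is positive. -/
def slopeProg (m : ℕ) : Prog :=
  .cond (.realLe (.var (m + 21)) (.const 0)) .skip
    (.seq (.cond (.realLe (.get (m + 22) (.const 1)) (.const 0))
        (.setNat (m + 26) (.const 1) (.const 1)) (.setNat (m + 26) (.const 1) (.const 0)))
      (.cond (.realLe (.get (m + 22) (.const 2)) (.const 0))
        (.setNat (m + 26) (.const 2) (.const 1)) (.setNat (m + 26) (.const 2) (.const 0))))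

theorem slopeProg_spec {m : ℕ} {σ : Conf n} {s : State} {Θ : ℝ → Prop}
    (hs : s.real (m + 21) 0 = σ.s)
    (hbit : ∀ i < 3, (Θ (s.real (m + 22) i) ∧ s.nat (m + 26) i = 1 ∨
        ¬ Θ (s.real (m + 22) i) ∧ s.nat (m + 26) i = 0)) :
    WP (slopeProg m) (slopeProg m).cost (fun s' =>
      (σ.Test Θ (s.real (m + 22) 1) ∧ s'.nat (m + 26) 1 = 1 ∨
        ¬ σ.Test Θ (s.real (m + 22) 1) ∧ s'.nat (m + 26) 1 = 0) ∧
      (σ.Test Θ (s.real (m + 22) 2) ∧ s'.nat (m + 26) 2 = 1 ∨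
        ¬ σ.Test Θ (s.real (m + 22) 2) ∧ s'.nat (m + 26) 2 = 0)) s := by
  refine WP.block (by simp [slopeProg, Prog.LoopFree]) ?_
  by_cases h : σ.s ≤ 0
  · have h1 := hbit 1 (by norm_num)
    have h2 := hbit 2 (by norm_num)
    simpa [slopeProg, Prog.exec, Test.Holds, RExpr.eval, NExpr.eval, hs, h, Conf.Test] using
      ⟨h1, h2⟩
  · by_cases h1 : s.real (m + 22) 1 ≤ 0 <;> by_cases h2 : s.real (m + 22) 2 ≤ 0 <;>
      simp [slopeProg, Prog.exec, Test.Holds, RExpr.eval, NExpr.eval, hs, h, Conf.Test, h1, h2,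
        State.nat_writeNat, State.real_writeNat]

/-- Place the sensor `j`. -/
def assignProg (m : ℕ) : Prog :=
  .cond (.natLe (.const 1) (.get (m + 26) (.const 1)))
    (.seq (.setReal (m + 20) (.const 0) (.add (.var (m + 20)) (.mul (.const 2)
        (.get 2 (.var (m + 25))))))
      (.seq (.setReal (m + 23) (.var (m + 25)) (.sub (.var (m + 20)) (.get 2 (.var (m + 25)))))
        (.setReal (m + 24) (.var (m + 25)) (.var (m + 21)))))
    (.cond (.natLe (.const 1) (.get (m + 26) (.const 2)))
      (.seq (.setReal (m + 20) (.const 0) (.add (.get 1 (.var (m + 25))) (.get 2 (.var (m + 25)))))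
        (.seq (.setReal (m + 21) (.const 0) (.const 1))
          (.seq (.setReal (m + 23) (.var (m + 25)) (.get 1 (.var (m + 25))))
            (.setReal (m + 24) (.var (m + 25)) (.const 1)))))
      .skip)

theorem assignProg_spec {O : Ranking I} {m : ℕ} {σ σ' : Conf n} {s : State} {Θ : ℝ → Prop}
    {j : Fin n} (hs : Shared O s) (hσ : Stores O m σ' s)
    (hσ' : σ' = { σ with Q := σ.Q.erase j }) (hj : s.nat (m + 25) 0 = j)
    (h1 : σ.Test Θ (σ.fitAt I j) ∧ s.nat (m + 26) 1 = 1 ∨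
        ¬ σ.Test Θ (σ.fitAt I j) ∧ s.nat (m + 26) 1 = 0)
    (h2 : σ.Test Θ (σ.liveAt I j) ∧ s.nat (m + 26) 2 = 1 ∨
        ¬ σ.Test Θ (σ.liveAt I j) ∧ s.nat (m + 26) 2 = 0) :
    WP (assignProg m) (assignProg m).cost (Stores O m (σ.place Θ I j)) s := by
  refine WP.block (by simp [assignProg, Prog.LoopFree]) ?_
  have hk := hσ.k
  have hc := hσ.c
  have hsl := hσ.slope
  have hyc := hσ.yc
  have hys := hσ.ys
  have ht := hσ.tree
  subst hσ'
  simp only at hk hc hsl hyc hys ht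
  have hx := hs.x
  have hr := hs.r
  unfold Conf.place
  rcases h1 with ⟨h1, hb1⟩ | ⟨h1, hb1⟩
  · rw [if_pos h1]
    refine ⟨?_, ?_, ?_, ?_, ?_, ?_⟩ <;>
      simp [assignProg, Prog.exec, Test.Holds, RExpr.eval, NExpr.eval, hb1, hj, hk, hc, hsl, hyc,
        hys, ht, hr, State.real_writeReal, State.nat_writeReal, Function.update_apply, Fin.ext_iff]
    -- The program has already advanced the covered end, so it computes the position as `(c + 2 * r)
    -- - r`.
    intro i
    congr 1
    ring
  · rw [if_neg h1]
    rcases h2 with ⟨h2, hb2⟩ | ⟨h2, hb2⟩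
    · rw [if_pos h2]
      refine ⟨?_, ?_, ?_, ?_, ?_, ?_⟩ <;>
        simp [assignProg, Prog.exec, Test.Holds, RExpr.eval, NExpr.eval, hb1, hb2, hj, hk, hyc,
          hys, ht, hx, hr, State.real_writeReal, State.nat_writeReal, Function.update_apply,
          Fin.ext_iff]
    · rw [if_neg h2]
      simpa [assignProg, Prog.exec, Test.Holds, NExpr.eval, hb1, hb2] using hσ

/-- Remove the front sensor from the tree and place it. -/
def placeProg (m : ℕ) : Prog :=
  .seq (.setNat (m + 23) (.const 0) (.add (.var 4) (.var (m + 24))))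
    (.seq (climb (m + 20) (m + 23) fun e => .sub e (.const 1))
      (.seq (slopeProg m) (assignProg m)))

theorem placeProg_spec {O : Ranking I} {m : ℕ} {σ : Conf n} {s : State} {Θ : ℝ → Prop}
    {j : Fin n} (hs : Shared O s) (hσ : Stores O m σ s) (hjQ : j ∈ σ.Q)
    (hq : s.nat (m + 24) 0 = O.rb j) (hj : s.nat (m + 25) 0 = j)
    (h1 : s.real (m + 22) 1 = σ.fitAt I j) (h2 : s.real (m + 22) 2 = σ.liveAt I j)
    (hbit : ∀ i < 3, (Θ (s.real (m + 22) i) ∧ s.nat (m + 26) i = 1 ∨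
        ¬ Θ (s.real (m + 22) i) ∧ s.nat (m + 26) i = 0)) :
    WP (placeProg m)
      (7 + (climbCost (m + 20) (m + 23) (fun e => .sub e (.const 1)) (Nat.clog 2 n + 1) +
        ((slopeProg m).cost + (assignProg m).cost)))
      (Stores O m (σ.place Θ I j)) s := by
  have hjlt : (O.rb j).val < 2 ^ Nat.clog 2 n :=
    (O.rb j).isLt.trans_le (Nat.le_pow_clog (by norm_num) n)
  refine WP.seq (((WP.block (Q := fun s' => s'.nat (m + 23) 0 = 2 ^ Nat.clog 2 n + O.rb j)
    (by simp [Prog.LoopFree]) ?_).frame (SN := {m + 23}) (SR := ∅)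
    (by simp [Prog.WritesIn])).mono (by simp [Prog.cost, NExpr.cost]) ?_)
  · simp [Prog.exec, NExpr.eval, State.nat_writeNat, hs.leaves, hq]
  rintro s1 ⟨hp, hA1⟩
  refine WP.seq (((WP.climb (g := fun u => u - 1) (by simp) (fun _ _ => rfl)
    (by rw [hp, pow_succ]; omega)).frame (SN := {m + 20, m + 23}) (SR := ∅)
    (by simp [climb, Prog.WritesIn])).mono le_rfl ?_)
  rintro s2 ⟨hT, hA2⟩
  rw [hp, hA1.1 (m + 20) (by simp)] at hT
  have hA : Agree {m + 20, m + 23} ∅ s s2 := (hA1.mono (by simp) (by simp)).trans hA2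
  have hreal : s2.real = s.real := funext fun a => hA.2 a (by simp)
  have hσ2 : Stores O m { σ with Q := σ.Q.erase j } s2 := by
    refine ⟨?_, ?_, ?_, ?_, ?_, ?_⟩
    · rw [hA.1 _ (by simp)]; exact hσ.k
    · rw [hreal]; exact hσ.c
    · rw [hreal]; exact hσ.slope
    · rw [hreal]; exact hσ.yc
    · rw [hreal]; exact hσ.ys
    · have := hσ.tree.erase (T' := s2.nat (m + 20)) (u := (O.rb j).val)
        (Finset.mem_image_of_mem _ hjQ) hT
      simp only [Ranking.ranks] at this ⊢
      rw [Finset.image_erase (f := fun i => (O.rb i).val)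
        (Fin.val_injective.comp O.rb.injective)]
      exact this
  have hs2 := hs.congr hA (by simp) (by simp)
  refine WP.seq (((slopeProg_spec (σ := σ) (Θ := Θ) hσ2.slope ?_).frame (SN := {m + 26}) (SR := ∅)
    (by simp [slopeProg, Prog.WritesIn])).mono le_rfl ?_)
  · rw [hreal, hA.1 (m + 26) (by simp)]
    exact hbit
  rintro s3 ⟨⟨hb1, hb2⟩, hA3⟩
  rw [hreal, h1] at hb1
  rw [hreal, h2] at hb2
  refine assignProg_spec (hs2.congr hA3 (by simp) (by simp)) (hσ2.congr ?_ ?_ ?_ ?_ ?_ ?_) rfl ?_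
    hb1 hb2
  · rw [hA3.1 _ (by simp)]
  · rw [hA3.1 _ (by simp)]
  · rw [hA3.2 _ (by simp)]
  · rw [hA3.2 _ (by simp)]
  · rw [hA3.2 _ (by simp)]
  · rw [hA3.2 _ (by simp)]
  · rw [hA3.1 _ (by simp), hA.1 _ (by simp)]; exact hj

/-- Use the answers to the queries. -/
def actProg (m : ℕ) : Prog :=
  .seq (.seq (.setNat (m + 27) (.const 0) (.const 0))
      (.cond (.natLt (.var (m + 21)) (.var 0))
        (.setNat (m + 27) (.const 0) (.get (m + 26) (.const 0))) .skip))
    (.cond (.natLe (.const 1) (.var (m + 27))) (releaseProg m)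
      (.cond (.natLe (.const 1) (.get (m + 20) (.const 1))) (placeProg m) .skip))

/-- A bound for the running time of `actProg`. -/
def actCost (m h : ℕ) : ℕ :=
  14 + (4 + ((9 + (climbCost (m + 20) (m + 23) (fun e => .add e (.const 1)) (h + 1) + 6)) +
    (4 + ((7 + (climbCost (m + 20) (m + 23) (fun e => .sub e (.const 1)) (h + 1) +
        ((slopeProg m).cost + (assignProg m).cost))) + 1))))

/-- All leaves lie below the root, so its counter is the number of waiting sensors and tests
emptiness in constant time. -/
theorem countsTree_root {O : Ranking I} {Q : Finset (Fin n)} {T : ℕ → ℕ}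
    (h : CountsTree (2 ^ Nat.clog 2 n) (O.ranks Q) T) : 1 ≤ T 1 ↔ Q.Nonempty := by
  classical
  have hpos := Nat.two_pow_pos (Nat.clog 2 n)
  rw [h 1 le_rfl (by omega), Finset.filter_true_of_mem, Nat.one_le_iff_ne_zero,
    ← Nat.pos_iff_ne_zero, Finset.card_pos, Ranking.ranks, Finset.image_nonempty]
  intro u hu
  have := O.lt_of_mem_ranks hu
  refine ⟨Nat.clog 2 n, ?_⟩
  rw [Nat.add_div_left _ hpos, Nat.div_eq_of_lt this]

theorem actProg_spec {O : Ranking I} {m : ℕ} {σ : Conf n} {s : State} {Θ : ℝ → Prop}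
    (hs : Shared O s) (hσ : Stores O m σ s)
    (hw : ∀ i ∈ σ.Q, (O.ra i).val < σ.k)
    (hq : ∀ h : σ.Q.Nonempty, s.nat (m + 24) 0 = O.rb (O.front h) ∧
      s.nat (m + 25) 0 = O.front h)
    (h0 : ∀ h : σ.k < n, s.real (m + 22) 0 = σ.releaseAt I (O.ra.symm ⟨σ.k, h⟩))
    (h12 : ∀ h : σ.Q.Nonempty, s.real (m + 22) 1 = σ.fitAt I (O.front h) ∧
      s.real (m + 22) 2 = σ.liveAt I (O.front h))
    (hbit : ∀ i < 3, (Θ (s.real (m + 22) i) ∧ s.nat (m + 26) i = 1 ∨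
        ¬ Θ (s.real (m + 22) i) ∧ s.nat (m + 26) i = 0)) :
    WP (actProg m) (actCost m (Nat.clog 2 n)) (Stores O m (σ.step O Θ)) s := by
  refine WP.seq (((WP.block (Q := fun s' => (σ.CanRelease O Θ ∧ s'.nat (m + 27) 0 = 1) ∨
      (¬ σ.CanRelease O Θ ∧ s'.nat (m + 27) 0 = 0))
    (by simp [Prog.LoopFree]) ?_).frame (SN := {m + 27}) (SR := ∅)
    (by simp [Prog.WritesIn])).mono (by simp [Prog.cost, NExpr.cost, Test.cost]) ?_)
  -- If all sensors are released, the first answer is meaningless and the flag stays 0.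
  · by_cases hk : σ.k < n
    · have := hbit 0 (by norm_num)
      rw [h0 hk] at this
      simpa [Prog.exec, NExpr.eval, State.nat_writeNat, Test.Holds, hσ.k, hs.size, hk,
        Conf.CanRelease] using this
    · simp [Prog.exec, NExpr.eval, State.nat_writeNat, Test.Holds, hσ.k, hs.size, hk,
        Conf.CanRelease]
  rintro s1 ⟨hf, hA⟩
  have hs1 := hs.congr hA (by simp) (by simp)
  have hreal : s1.real = s.real := funext fun a => hA.2 a (by simp)
  have hσ1 : Stores O m σ s1 := by
    refine hσ.congr (hA.1 _ (by simp)) (hA.1 _ (by simp)) ?_ ?_ ?_ ?_ <;> rw [hreal]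
  refine (WP.cond (B := (9 + (climbCost (m + 20) (m + 23) (fun e => .add e (.const 1))
      (Nat.clog 2 n + 1) + 6)) + (4 + ((7 + (climbCost (m + 20) (m + 23)
      (fun e => .sub e (.const 1)) (Nat.clog 2 n + 1) +
        ((slopeProg m).cost + (assignProg m).cost))) + 1))) ?_ ?_).mono
    (by simp [Test.cost, NExpr.cost]) fun _ h => h
  · intro hb
    simp only [Test.Holds, NExpr.eval] at hb
    rcases hf with ⟨hc, -⟩ | ⟨-, hf⟩
    -- The counters would be wrong if a sensor were inserted twice; waiting sensors have release
    -- rank below `σ.k`.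
    · have hnot : O.ra.symm ⟨σ.k, hc.1⟩ ∉ σ.Q := fun h => by simpa using hw _ h
      unfold Conf.step
      rw [dif_pos hc]
      exact (releaseProg_spec hs1 hσ1 hc.1 hnot).mono (Nat.le_add_right _ _) fun _ h => h
    · omega
  · intro hb
    simp only [Test.Holds, NExpr.eval] at hb
    rcases hf with ⟨-, hf⟩ | ⟨hc, -⟩
    · omega
    · unfold Conf.step
      rw [dif_neg hc]
      have hroot := countsTree_root hσ1.tree
      refine (WP.cond (B := (7 + (climbCost (m + 20) (m + 23)
        (fun e => .sub e (.const 1)) (Nat.clog 2 n + 1) +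
        ((slopeProg m).cost + (assignProg m).cost))) + 1) ?_ ?_).mono
        (by simp only [Test.cost, NExpr.cost]; omega) fun _ h => h
      · intro hb
        simp only [Test.Holds, NExpr.eval] at hb
        have hQ := hroot.1 hb
        rw [dif_pos hQ]
        refine (placeProg_spec hs1 hσ1 (O.front_mem hQ) ?_ ?_ ?_ ?_ ?_).mono
          (Nat.le_add_right _ _) fun _ h => h
        · rw [hA.1 _ (by simp)]; exact (hq hQ).1
        · rw [hA.1 _ (by simp)]; exact (hq hQ).2
        · rw [hreal]; exact (h12 hQ).1
        · rw [hreal]; exact (h12 hQ).2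
        · rw [hreal, hA.1 _ (by simp)]; exact hbit
      · intro hb
        simp only [Test.Holds, NExpr.eval] at hb
        rw [dif_neg fun h => hb (hroot.2 h)]
        exact ⟨1, s1, Run.skip _, by omega, hσ1⟩

end Greedy

end BCLS

/-! ### The greedy algorithm in memory: initialization and main loop. -/

namespace BCLS

open RealRAM

section Greedy

variable {n : ℕ} {I : Input n}

/-- One step of the greedy algorithm. -/
def stepProg (m : ℕ) (cmp : ℕ → Prog) : Prog :=
  .seq (findProg m) (.seq (thresholdProg m)
    (.seq (.seq (cmp 0) (.seq (cmp 1) (cmp 2))) (actProg m)))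

/-- A bound for the running time of `stepProg`. -/
def stepCost (m B h : ℕ) : ℕ :=
  descendCost h + 12 + ((thresholdProg m).cost + (B + (B + B) + actCost m h))

/-- The last conjunct protects the counter of the surrounding loop, which is the array of naturals
`m + 22`. -/
theorem stepProg_spec {O : Ranking I} {m B : ℕ} {cmp : ℕ → Prog} {Θ : ℝ → Prop}
    {J : Set ℝ → State → Prop} (hc : Comparator O m cmp B Θ J) {S : Set ℝ} {σ : Conf n}
    {s : State} (hs : Shared O s) (hσ : Stores O m σ s) (hJ : J S s)
    (hw : ∀ i ∈ σ.Q, (O.ra i).val < σ.k) :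
    WP (stepProg m cmp) (stepCost m B (Nat.clog 2 n)) (fun s' => Shared O s' ∧
      Stores O m (σ.step O Θ) s' ∧ (∃ S', S ⊆ S' ∧ σ.asked O ⊆ S' ∧ J S' s') ∧
      s'.nat (m + 22) = s.nat (m + 22)) s := by
  refine WP.seq ((findProg_spec hs hσ).mono le_rfl ?_)
  rintro s1 ⟨hq, hA1⟩
  have hs1 := hs.congr hA1 (by simp) (by simp)
  have hσ1 : Stores O m σ s1 := by
    refine hσ.congr (hA1.1 _ (by simp)) (hA1.1 _ (by simp)) (hA1.2 _ (by simp))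
      (hA1.2 _ (by simp)) (hA1.2 _ (by simp)) (hA1.2 _ (by simp))
  refine WP.seq ((thresholdProg_spec hs1 hσ1 fun h => (hq h).2).mono le_rfl ?_)
  rintro s2 ⟨⟨h0, h12⟩, hA2⟩
  have hs2 := hs1.congr hA2 (by simp) (by simp)
  have hσ2 : Stores O m σ s2 := by
    refine hσ1.congr (hA2.1 _ (by simp)) (hA2.1 _ (by simp)) (hA2.2 _ (by simp))
      (hA2.2 _ (by simp)) (hA2.2 _ (by simp)) (hA2.2 _ (by simp))
  have hJ2 : J S s2 := by
    refine hc.frame S s s2 ((hA1.mono ?_ ?_).trans (hA2.mono ?_ ?_)) hJ <;>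
      · intro a; simp [Own]; try omega
  refine WP.seq ((hc.three hs2 hJ2).mono le_rfl ?_)
  rintro s3 ⟨hs3, hJ3, hn3, hr3, hb3⟩
  have hσ3 : Stores O m σ s3 :=
    hσ2.congr (hn3 _ (by simp [Own]) (by simp)) (hn3 _ (by simp [Own]) (by simp))
      (hr3 _ (by simp [Own])) (hr3 _ (by simp [Own])) (hr3 _ (by simp [Own]))
      (hr3 _ (by simp [Own]))
  have e22 : s3.real (m + 22) = s2.real (m + 22) := hr3 _ (by simp [Own])
  have e24 : s3.nat (m + 24) = s1.nat (m + 24) := by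
    rw [hn3 _ (by simp [Own]) (by simp), hA2.1 _ (by simp)]
  have e25 : s3.nat (m + 25) = s1.nat (m + 25) := by
    rw [hn3 _ (by simp [Own]) (by simp), hA2.1 _ (by simp)]
  refine ((actProg_spec (Θ := Θ) hs3 hσ3 hw (by rw [e24, e25]; exact hq) (by rw [e22]; exact h0)
    (by rw [e22]; exact h12) (by rw [e22]; exact hb3)).frame
    (SN := {m + 20, m + 21, m + 23, m + 26, m + 27}) (SR := {m + 20, m + 21, m + 23, m + 24})
    (by simp [actProg, releaseProg, placeProg, climb, slopeProg, assignProg,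
      Prog.WritesIn])).mono le_rfl ?_
  rintro s4 ⟨hσ4, hA4⟩
  refine ⟨hs3.congr hA4 (by simp) (by simp), hσ4,
    ⟨_, ?_, ?_, hc.frame _ s3 s4 (hA4.mono ?_ ?_) hJ3⟩, ?_⟩
  · exact fun q hq => Or.inr (Or.inr (Or.inr hq))
  · rintro q (⟨h, rfl⟩ | ⟨h, rfl | rfl⟩)
    · exact Or.inr (Or.inr (Or.inl (h0 h).symm))
    · exact Or.inr (Or.inl (h12 h).1.symm)
    · exact Or.inl (h12 h).2.symm
  · intro a; simp [Own]; omega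
  · intro a; simp [Own]; omega
  · rw [hA4.1 _ (by simp), hn3 _ (by simp [Own]) (by simp), hA2.1 _ (by simp), hA1.1 _ (by simp)]

/-- Set up the initial configuration. -/
def startProg (m : ℕ) : Prog :=
  .seq (.forLoop (m + 22) (.add (.var 4) (.var 4))
      (.setNat (m + 20) (.var (m + 22)) (.const 0)))
    (.seq (.forLoop (m + 22) (.var 0)
      (.seq (.setReal (m + 23) (.var (m + 22)) (.get 1 (.var (m + 22))))
        (.setReal (m + 24) (.var (m + 22)) (.const 0))))
      (.seq (.setNat (m + 21) (.const 0) (.const 0))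
        (.seq (.setReal (m + 20) (.const 0) (.const 0)) (.setReal (m + 21) (.const 0) (.const 0)))))

/-- A bound for the running time of `startProg`. -/
def startCost (n h : ℕ) : ℕ :=
  (2 ^ h + 2 ^ h + 1) * (4 + 5 + 9) + ((n + 1) * (10 + 2 + 9) + 9)

theorem startProg_spec {O : Ranking I} {m : ℕ} {s : State} (hs : Shared O s) :
    WP (startProg m) (startCost n (Nat.clog 2 n)) (Stores O m (Conf.start I)) s := by
  refine WP.seq (((WP.forLoop (n := 2 ^ Nat.clog 2 n + 2 ^ Nat.clog 2 n) (B := 4)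
    (fun i s' => Agree {m + 20, m + 22} ∅ s s' ∧ ∀ q < i, s'.nat (m + 20) q = 0)
    ?_ ?_ ?_)).mono (by simp [NExpr.cost]) ?_)
  · rintro i s' ⟨hA, -⟩
    have := hs.congr hA (by simp) (by simp)
    simp [NExpr.eval, this.leaves]
  · exact ⟨⟨fun a ha => State.nat_writeNat_of_ne (by simp at ha; tauto) _ _ _, fun _ _ => rfl⟩,
      by simp⟩
  · rintro i s' hi ⟨hA, h⟩ hv
    refine (WP.block (by simp [Prog.LoopFree]) ?_).mono (by simp [Prog.cost, NExpr.cost])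
      fun _ h => h
    simp only [Prog.exec, NExpr.eval, hv]
    refine ⟨by simp [State.nat_writeNat, hv], ⟨fun a ha => ?_, fun a ha => ?_⟩, fun q hq => ?_⟩
    · simp at ha
      rw [State.nat_writeNat_of_ne ha.2, State.nat_writeNat_of_ne ha.1]
      exact hA.1 a (by simp [ha])
    · exact hA.2 a ha
    · by_cases hqi : q = i
      · simp [State.nat_writeNat, hqi]
      · simpa [State.nat_writeNat, hqi] using h q (by omega)
  rintro s1 ⟨hA1, hT⟩
  have hs1 := hs.congr hA1 (by simp) (by simp)
  refine WP.seq (((WP.forLoop (n := n) (B := 10)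
    (fun i s' => Agree {m + 22} {m + 23, m + 24} s1 s' ∧
      ∀ q : Fin n, q.val < i → s'.real (m + 23) q = I.x q ∧ s'.real (m + 24) q = 0)
    ?_ ?_ ?_)).mono (by simp [NExpr.cost]) ?_)
  · rintro i s' ⟨hA, -⟩
    have := hs1.congr hA (by simp) (by simp)
    simp [NExpr.eval, this.size]
  · exact ⟨⟨fun a ha => State.nat_writeNat_of_ne (by simpa using ha) _ _ _, fun _ _ => rfl⟩,
      by simp⟩
  · rintro i s' hi ⟨hA, h⟩ hv
    have hs' := hs1.congr hA (by simp) (by simp)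
    refine (WP.block (by simp [Prog.LoopFree]) ?_).mono
      (by simp [Prog.cost, NExpr.cost, RExpr.cost]) fun _ h => h
    simp only [Prog.exec, NExpr.eval, RExpr.eval, hv, State.nat_writeReal]
    refine ⟨trivial, ⟨fun a ha => ?_, fun a ha => ?_⟩, fun q hq => ?_⟩
    · rw [State.nat_writeNat_of_ne (by simpa using ha)]
      exact hA.1 a ha
    · simp at ha
      rw [State.real_writeNat, State.real_writeReal_of_ne ha.2, State.real_writeReal_of_ne ha.1]
      exact hA.2 a (by simp [ha])
    · by_cases hqi : q.val = i
      · have := hs'.x q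
        rw [hqi] at this
        simp [State.real_writeNat, State.real_writeReal, hqi, this]
      · simpa [State.real_writeNat, State.real_writeReal, hqi] using h q (by omega)
  rintro s2 ⟨hA2, hy⟩
  refine (WP.block (by simp [Prog.LoopFree]) ?_).mono
    (by simp [Prog.cost, NExpr.cost, RExpr.cost]) fun _ h => h
  refine ⟨?_, ?_, ?_, ?_, ?_, ?_⟩
  · simp [Prog.exec, NExpr.eval, State.nat_writeNat, State.nat_writeReal, Conf.start]
  · simp [Prog.exec, NExpr.eval, RExpr.eval, State.real_writeReal, Conf.start]
  · simp [Prog.exec, NExpr.eval, RExpr.eval, State.real_writeReal, Conf.start]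
  · intro i
    simp [Prog.exec, State.real_writeReal, State.real_writeNat, Conf.start, hy i i.isLt]
  · intro i
    simp [Prog.exec, State.real_writeReal, State.real_writeNat, Conf.start, hy i i.isLt]
  · intro q hq1 hq2
    have := hT q (by omega)
    rw [← hA2.1 (m + 20) (by simp)] at this
    simp [Prog.exec, State.nat_writeReal, State.nat_writeNat, Conf.start, Ranking.ranks, this]

/-- The greedy algorithm. -/
def greedyProg (m : ℕ) (cmp : ℕ → Prog) : Prog :=
  .seq (startProg m) (.forLoop (m + 22) (.add (.var 0) (.var 0)) (stepProg m cmp))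

/-- A bound for the running time of `greedyProg`. -/
def greedyCost (m B n h : ℕ) : ℕ := startCost n h + (2 * n + 1) * (stepCost m B h + 5 + 9)

/-- `Conf.Good` speaks of a run with a real parameter. The symbolic run has arbitrary answers `Θ`,
so this part of the invariant is established separately. -/
theorem Conf.waiting_iterate (O : Ranking I) (Θ : ℝ → Prop) (t : ℕ) :
    ∀ i ∈ ((Conf.step O Θ)^[t] (Conf.start I)).Q,
      (O.ra i).val < ((Conf.step O Θ)^[t] (Conf.start I)).k := by
  induction t with
  | zero => simp [Conf.start]
  | succ t ih =>
    rw [Function.iterate_succ_apply']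
    generalize (Conf.step O Θ)^[t] (Conf.start I) = σ at ih
    unfold Conf.step
    by_cases hc : σ.CanRelease O Θ
    · rw [dif_pos hc]
      intro i hi
      rcases Finset.mem_insert.1 hi with rfl | hi
      · simp
      · exact (ih i hi).trans (Nat.lt_succ_self _)
    · rw [dif_neg hc]
      by_cases hQ : σ.Q.Nonempty
      · rw [dif_pos hQ, Conf.place_Q, Conf.place_k]
        exact fun i hi => ih i (Finset.mem_of_mem_erase hi)
      · rw [dif_neg hQ]; exact ih

theorem greedyProg_spec {O : Ranking I} {m B : ℕ} {cmp : ℕ → Prog} {Θ : ℝ → Prop}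
    {J : Set ℝ → State → Prop} (hc : Comparator O m cmp B Θ J) {S : Set ℝ}
    {s : State} (hs : Shared O s) (hJ : J S s) :
    WP (greedyProg m cmp) (greedyCost m B n (Nat.clog 2 n)) (fun s' => Shared O s' ∧
      Stores O m (O.final Θ) s' ∧ ∃ S', S ⊆ S' ∧
        (∀ t < 2 * n, ((Conf.step O Θ)^[t] (Conf.start I)).asked O ⊆ S') ∧ J S' s') s := by
  refine WP.seq (((startProg_spec hs).frame (SN := {m + 20, m + 21, m + 22})
    (SR := {m + 20, m + 21, m + 23, m + 24})
    (by simp [startProg, Prog.forLoop, Prog.WritesIn])).mono le_rfl ?_)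
  rintro s1 ⟨hσ, hA⟩
  refine (WP.forLoop (n := 2 * n) (B := stepCost m B (Nat.clog 2 n)) (fun t s' => Shared O s' ∧
    Stores O m ((Conf.step O Θ)^[t] (Conf.start I)) s' ∧ ∃ S', S ⊆ S' ∧
      (∀ t' < t, ((Conf.step O Θ)^[t'] (Conf.start I)).asked O ⊆ S') ∧ J S' s')
    ?_ ?_ ?_).mono (by simp [NExpr.cost]) fun _ h => h
  · rintro i s' ⟨h, -⟩
    simp [NExpr.eval, h.size, two_mul]
  · have hA' : Agree {m + 22} ∅ s1 (s1.writeNat (m + 22) 0 0) :=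
      ⟨fun a ha => State.nat_writeNat_of_ne (by simpa using ha) _ _ _, fun _ _ => rfl⟩
    refine ⟨(hs.congr hA (by simp) (by simp)).congr hA' (by simp) (by simp),
      hσ.congr (hA'.1 _ (by simp)) (hA'.1 _ (by simp)) rfl rfl rfl rfl, S, subset_rfl, by simp,
      hc.frame S s _ ((hA.mono ?_ ?_).trans (hA'.mono ?_ ?_)) hJ⟩ <;>
      · intro a; simp [Own]; try omega
  · rintro i s' hi ⟨h1, h2, S', hSS', hask, hJ'⟩ hv
    refine (stepProg_spec hc h1 h2 hJ' (Conf.waiting_iterate O Θ i)).mono le_rfl ?_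
    rintro s2 ⟨h3, h4, ⟨S2, hS2, hask2, hJ2⟩, h5⟩
    have hA' : Agree {m + 22} ∅ s2 (s2.writeNat (m + 22) 0 (i + 1)) :=
      ⟨fun a ha => State.nat_writeNat_of_ne (by simpa using ha) _ _ _, fun _ _ => rfl⟩
    refine ⟨by rw [h5, hv], h3.congr hA' (by simp) (by simp), ?_, S2, hSS'.trans hS2, ?_,
      hc.frame S2 s2 _ (hA'.mono ?_ ?_) hJ2⟩
    · rw [Function.iterate_succ_apply']
      exact h4.congr (hA'.1 _ (by simp)) (hA'.1 _ (by simp)) rfl rfl rfl rfl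
    · intro t ht
      rcases Nat.lt_succ_iff_lt_or_eq.1 ht with h | rfl
      · exact (hask t h).trans hS2
      · exact hask2
    · intro a; simp [Own]; omega
    · simp

end Greedy

end BCLS

/-! ### Decision procedure, oracle and search for the optimum. -/

namespace BCLS

open RealRAM

section Optimize

variable {n : ℕ} {I : Input n}

/-- Compare the `i`-th query of the first copy of the greedy algorithm with the parameter. -/
def directCmp (i : ℕ) : Prog :=
  .cond (.realLe (.get 22 (.const i)) (.var 4))
    (.setNat 26 (.const i) (.const 1)) (.setNat 26 (.const i) (.const 0))

/-- For a known parameter no history is needed; the predicate on states only fixes the cell that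
contains the parameter. -/
theorem directCmp_comparator (O : Ranking I) (lam : ℝ) :
    Comparator O 0 directCmp 11 (· ≤ lam) fun _ s => s.real 4 0 = lam where
  run := by
    intro i S s hs hJ
    have h := WP.block (P := directCmp i) (s := s) (by simp [directCmp, Prog.LoopFree])
      (Q := fun s' => s'.real = s.real ∧
        (∀ i', i' ≠ i → s'.nat 26 i' = s.nat 26 i') ∧
        (s.real 22 i ≤ lam ∧ s'.nat 26 i = 1 ∨ ¬ s.real 22 i ≤ lam ∧ s'.nat 26 i = 0)) (by
        by_cases hb : s.real 22 i ≤ lam <;>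
          simp +contextual [directCmp, Prog.exec, Test.Holds, RExpr.eval, NExpr.eval, hJ, hb,
            State.nat_writeNat, State.real_writeNat])
    refine (h.frame (SN := {26}) (SR := ∅) (by simp [directCmp, Prog.WritesIn])).mono
      (by simp [directCmp, Prog.cost, Test.cost, RExpr.cost, NExpr.cost]) ?_
    rintro s' ⟨⟨h1, h2, h3⟩, hA⟩
    exact ⟨hs.congr hA (by simp) (by simp), by rw [h1]; exact hJ,
      fun a _ ha => hA.1 a (by simpa using ha), fun a _ => by rw [h1], h2, h3⟩
  frame := by
    intro S s s' hA h
    rw [hA.2 4 (by simp [Own])]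
    exact h

/-- Decide whether the parameter is feasible. -/
def decideProg : Prog :=
  .seq (greedyProg 0 directCmp)
    (.cond (.realLe (.var 0) (.add (.var 20) (.mul (.var 21) (.var 4))))
      (.setNat 10 (.const 0) (.const 1)) (.setNat 10 (.const 0) (.const 0)))

/-- A bound for the running time of `decideProg`. -/
def decideCost (n h : ℕ) : ℕ := greedyCost 0 11 n h + 17

/-- The decision works in `Own 0` and the symbolic run in the disjoint `Own 20`, so a decision made
to answer a query leaves the symbolic run intact. -/
theorem decideProg_writesIn : decideProg.WritesIn (insert 10 (Own 0)) (Own 0) := by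
  simp [decideProg, greedyProg, startProg, stepProg, findProg, thresholdProg, actProg, releaseProg,
    placeProg, slopeProg, assignProg, climb, descend, directCmp, Prog.forLoop, Prog.WritesIn, Own]

theorem decideProg_spec {O : Ranking I} {lam : ℝ} (hlam : 0 ≤ lam) {s : State} (hs : Shared O s)
    (h4 : s.real 4 0 = lam) :
    WP decideProg (decideCost n (Nat.clog 2 n)) (fun s' => (Shared O s' ∧
      Stores O 0 (O.final (· ≤ lam)) s' ∧
      (I.Feasible lam ∧ s'.nat 10 0 = 1 ∨ ¬ I.Feasible lam ∧ s'.nat 10 0 = 0)) ∧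
      Agree (insert 10 (Own 0)) (Own 0) s s') s := by
  refine WP.frame ?_ decideProg_writesIn
  refine WP.seq ((greedyProg_spec (directCmp_comparator O lam) (S := ∅) hs h4).mono le_rfl ?_)
  rintro s1 ⟨hs1, hσ, -, -, -, h4'⟩
  have hval : s1.real 20 0 + s1.real 21 0 * s1.real 4 0 = (O.final (· ≤ lam)).val lam := by
    rw [Conf.val, ← hσ.c, ← hσ.slope, h4']
  refine ((WP.block (by simp [Prog.LoopFree]) ?_).frame (SN := {10}) (SR := ∅)
    (Q := fun s' => I.Feasible lam ∧ s'.nat 10 0 = 1 ∨ ¬ I.Feasible lam ∧ s'.nat 10 0 = 0)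
    (by simp [Prog.WritesIn])).mono
    (by simp [Prog.cost, Test.cost, RExpr.cost, NExpr.cost]) ?_
  · rw [← O.le_final_iff hlam, ← hval]
    by_cases hb : I.L ≤ s1.real 20 0 + s1.real 21 0 * s1.real 4 0 <;>
      simp [Prog.exec, Test.Holds, RExpr.eval, NExpr.eval, hs1.len, hb, State.nat_writeNat]
  · rintro s2 ⟨h, hA⟩
    exact ⟨hs1.congr hA (by simp) (by simp), hσ.congr (hA.1 _ (by simp)) (hA.1 _ (by simp))
      (hA.2 _ (by simp)) (hA.2 _ (by simp)) (hA.2 _ (by simp)) (hA.2 _ (by simp)), h⟩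

/-- The state of the search: array `5` of the real numbers contains the least feasible query in
`S`, if array `11` of the natural numbers tells that there is one. -/
def Search (I : Input n) (S : Set ℝ) (s : State) : Prop :=
  S.Finite ∧ ((s.nat 11 0 = 0 ∧ ∀ q ∈ S, I.Below q) ∨
    (s.nat 11 0 = 1 ∧ 0 ≤ s.real 5 0 ∧ I.Feasible (s.real 5 0) ∧
      ∀ q ∈ S, 0 ≤ q → I.Feasible q → s.real 5 0 ≤ q))

/-- Record the outcome of a decision. -/
def recordProg (i : ℕ) : Prog :=
  .cond (.natLe (.const 1) (.var 10))
    (.seq (.setNat 46 (.const i) (.const 0))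
      (.cond (.natLe (.var 11) (.const 0))
        (.seq (.setNat 11 (.const 0) (.const 1)) (.setReal 5 (.const 0) (.var 4)))
        (.cond (.realLt (.var 4) (.var 5)) (.setReal 5 (.const 0) (.var 4)) .skip)))
    .skip

/-- Answer the `i`-th query of the second copy of the greedy algorithm by a decision. -/
def oracleCmp (i : ℕ) : Prog :=
  .seq (.setNat 46 (.const i) (.const 1))
    (.cond (.realLe (.const 0) (.get 42 (.const i)))
      (.seq (.setReal 4 (.const 0) (.get 42 (.const i))) (.seq decideProg (recordProg i)))
      .skip)

/-- A bound for the running time of `oracleCmp`. -/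
def oracleCost (n h : ℕ) : ℕ := 3 + (4 + (4 + (decideCost n h + 35)))

theorem Search.congr {S : Set ℝ} {s s' : State} (h : Search I S s) (h1 : s'.nat 11 = s.nat 11)
    (h2 : s'.real 5 = s.real 5) : Search I S s' := by
  unfold Search
  rw [h1, h2]
  exact h

theorem Search.insert_of_below {S : Set ℝ} {s : State} (h : Search I S s) {q : ℝ}
    (hq : I.Below q) : Search I (insert q S) s := by
  refine ⟨h.1.insert q, ?_⟩
  rcases h.2 with ⟨h1, h2⟩ | ⟨h1, h2, h3, h4⟩
  · left
    refine ⟨h1, ?_⟩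
    rintro q' (rfl | hq')
    · exact hq
    · exact h2 q' hq'
  · right
    refine ⟨h1, h2, h3, ?_⟩
    rintro q' (rfl | hq') h5 h6
    · exact absurd ⟨h5, h6⟩ hq
    · exact h4 q' hq' h5 h6

theorem recordProg_spec {S : Set ℝ} {s : State} {lam : ℝ} {i : ℕ} (hlam : 0 ≤ lam)
    (h : Search I S s) (h4 : s.real 4 0 = lam)
    (hok : I.Feasible lam ∧ s.nat 10 0 = 1 ∨ ¬ I.Feasible lam ∧ s.nat 10 0 = 0)
    (hbit : s.nat 46 i = 1) :
    WP (recordProg i) 35 (fun s' => Search I (insert lam S) s' ∧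
      (∀ i', i' ≠ i → s'.nat 46 i' = s.nat 46 i') ∧
      (I.Below lam ∧ s'.nat 46 i = 1 ∨ ¬ I.Below lam ∧ s'.nat 46 i = 0)) s := by
  refine (WP.block (by simp [recordProg, Prog.LoopFree]) ?_).mono
    (by simp [recordProg, Prog.cost, Test.cost, NExpr.cost, RExpr.cost]) fun _ h => h
  rcases hok with ⟨hf, hok⟩ | ⟨hf, hok⟩
  · have hB : ¬ I.Below lam := fun h => h ⟨hlam, hf⟩
    rcases h with ⟨hS, ⟨h1, h2⟩ | ⟨h1, h2, h3, h5⟩⟩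
    · simp +contextual [recordProg, Prog.exec, Test.Holds, NExpr.eval, RExpr.eval, hok, h1, h4, hB,
        State.nat_writeNat, State.real_writeNat, State.nat_writeReal, State.real_writeReal,
        Search, hS, hlam, hf]
      intro q hq h6 h7
      exact absurd ⟨h6, h7⟩ (h2 q hq)
    · by_cases hlt : lam < s.real 5 0
      · simp +contextual [recordProg, Prog.exec, Test.Holds, NExpr.eval, RExpr.eval, hok, h1, h4,
          hB, State.nat_writeNat, State.real_writeNat, State.nat_writeReal, State.real_writeReal,
          Search, hS, hlam, hf, hlt]
        intro q hq h6 h7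
        exact hlt.le.trans (h5 q hq h6 h7)
      · simp +contextual [recordProg, Prog.exec, Test.Holds, NExpr.eval, RExpr.eval, hok, h1, h4,
          hB, State.nat_writeNat, State.real_writeNat, Search, hS, hlt]
        exact ⟨h2, h3, fun _ _ => not_lt.1 hlt, h5⟩
  · have hB : I.Below lam := fun h => hf h.2
    simp only [recordProg, Prog.exec, Test.Holds, NExpr.eval, hok, hB]
    exact ⟨h.insert_of_below hB, fun _ _ => rfl, Or.inl ⟨trivial, hbit⟩⟩

/-- The answer is preset to 1 and revoked only when a decision finds the query feasible. Negative
queries are below the parameter by definition and need no decision. -/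
theorem oracleCmp_comparator (O : Ranking I) :
    Comparator O 20 oracleCmp (oracleCost n (Nat.clog 2 n)) I.Below (Search I) where
  run := by
    intro i S s hs hJ
    simp only [Nat.reduceAdd]
    refine WP.seq (((WP.block (by simp [Prog.LoopFree]) ?_).frame (SN := {46}) (SR := ∅)
      (Q := fun s' => (∀ i', i' ≠ i → s'.nat 46 i' = s.nat 46 i') ∧ s'.nat 46 i = 1)
      (by simp [Prog.WritesIn])).mono (by simp [Prog.cost, NExpr.cost]) ?_)
    · simp +contextual [Prog.exec, NExpr.eval, State.nat_writeNat]
    rintro s1 ⟨⟨hb1, hb1'⟩, hA1⟩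
    have hs1 := hs.congr hA1 (by simp) (by simp)
    have hJ1 : Search I S s1 := hJ.congr (hA1.1 _ (by simp)) (hA1.2 _ (by simp))
    have h42 : s1.real 42 = s.real 42 := hA1.2 _ (by simp)
    refine (WP.cond (B := 4 + (decideCost n (Nat.clog 2 n) + 35)) ?_ ?_).mono
      (by simp [Test.cost, NExpr.cost, RExpr.cost]) fun _ h => h
    · intro hq
      simp only [Test.Holds, RExpr.eval, NExpr.eval, h42, Rat.cast_zero] at hq
      refine WP.seq (((WP.block (by simp [Prog.LoopFree]) ?_).frame (SN := ∅) (SR := {4})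
        (Q := fun s' => s'.real 4 0 = s.real 42 i) (by simp [Prog.WritesIn])).mono
        (by simp [Prog.cost, NExpr.cost, RExpr.cost]) ?_)
      · simp [Prog.exec, NExpr.eval, RExpr.eval, State.real_writeReal, h42]
      rintro s2 ⟨h4, hA2⟩
      have hs2 := hs1.congr hA2 (by simp) (by simp)
      have hJ2 : Search I S s2 := hJ1.congr (hA2.1 _ (by simp)) (hA2.2 _ (by simp))
      refine WP.seq ((decideProg_spec hq hs2 h4).mono le_rfl ?_)
      rintro s3 ⟨⟨hs3, -, hok⟩, hA3⟩
      have hJ3 : Search I S s3 :=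
        hJ2.congr (hA3.1 _ (by simp [Own])) (hA3.2 _ (by simp [Own]))
      have h46 : s3.nat 46 = s1.nat 46 := by
        rw [hA3.1 _ (by simp [Own]), hA2.1 _ (by simp)]
      refine ((recordProg_spec hq hJ3 (by rw [hA3.2 _ (by simp [Own])]; exact h4) hok
        (i := i) (by rw [h46]; exact hb1')).frame (SN := {46, 11}) (SR := {5})
        (by simp [recordProg, Prog.WritesIn])).mono le_rfl ?_
      rintro s4 ⟨⟨hJ4, hb4, hans⟩, hA4⟩
      refine ⟨hs3.congr hA4 (by simp) (by simp), hJ4, ?_, ?_, ?_, hans⟩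
      · intro a ha ha'
        rw [hA4.1 a (by simp [Own] at ha ⊢; omega), hA3.1 a (by simp [Own] at ha ⊢; omega),
          hA2.1 a (by simp), hA1.1 a (by simpa using ha')]
      · intro a ha
        rw [hA4.2 a (by simp [Own] at ha ⊢; omega), hA3.2 a (by simp [Own] at ha ⊢; omega),
          hA2.2 a (by simp [Own] at ha ⊢; omega), hA1.2 a (by simp)]
      · intro i' hi'
        rw [hb4 i' hi', h46, hb1 i' hi']
    · intro hq
      simp only [Test.Holds, RExpr.eval, NExpr.eval, h42, Rat.cast_zero] at hq
      have hB : I.Below (s.real 42 i) := fun h => hq h.1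
      refine ⟨1, s1, Run.skip _, by omega, hs1, hJ1.insert_of_below hB, ?_, ?_, hb1,
        Or.inl ⟨hB, hb1'⟩⟩
      · exact fun a _ ha => hA1.1 a (by simpa using ha)
      · exact fun a _ => hA1.2 a (by simp)
  frame := by
    intro S s s' hA h
    exact h.congr (hA.1 _ (by simp [Own])) (hA.2 _ (by simp [Own]))

/-- Find the optimum. -/
def searchProg : Prog :=
  .seq (.seq (.setNat 11 (.const 0) (.const 0)) (.setReal 42 (.const 0) (.const 0)))
    (.seq (oracleCmp 0)
      (.seq (greedyProg 20 oracleCmp)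
        (.seq (.setReal 42 (.const 0) (.div (.sub (.var 0) (.var 40)) (.var 41)))
          (oracleCmp 0))))

/-- A bound for the running time of `searchProg`. -/
def searchCost (n h : ℕ) : ℕ :=
  6 + (oracleCost n h + (greedyCost 20 (oracleCost n h) n h + (10 + oracleCost n h)))

theorem searchProg_spec {O : Ranking I} {s : State} (hs : Shared O s) :
    WP searchProg (searchCost n (Nat.clog 2 n)) (fun s' => Shared O s' ∧ 0 ≤ s'.real 5 0 ∧
      I.Feasible (s'.real 5 0) ∧ ∀ mu, 0 ≤ mu → I.Feasible mu → s'.real 5 0 ≤ mu) s := by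
  have hc := oracleCmp_comparator O
  refine WP.seq (((WP.block (by simp [Prog.LoopFree]) ?_).frame (SN := {11}) (SR := {42})
    (Q := fun s' => s'.nat 11 0 = 0 ∧ s'.real 42 0 = 0) (by simp [Prog.WritesIn])).mono
    (by simp [Prog.cost, NExpr.cost, RExpr.cost]) ?_)
  · simp [Prog.exec, NExpr.eval, RExpr.eval, State.nat_writeNat, State.nat_writeReal,
      State.real_writeReal]
  rintro s1 ⟨⟨hflag, h0⟩, hA1⟩
  have hs1 := hs.congr hA1 (by simp) (by simp)
  have hJ1 : Search I ∅ s1 := ⟨Set.finite_empty, Or.inl ⟨hflag, by simp⟩⟩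
  -- The query 0 is made first, as `Ranking.exists_query_le` requires.
  refine WP.seq ((hc.run 0 ∅ s1 hs1 hJ1).mono le_rfl ?_)
  rintro s2 ⟨hs2, hJ2, -⟩
  simp only [Nat.reduceAdd, h0] at hJ2
  refine WP.seq ((greedyProg_spec hc hs2 hJ2).mono le_rfl ?_)
  rintro s3 ⟨hs3, hσ, S, h0S, hask, hJ3⟩
  -- If the slope is 0, the quotient is 0 by convention, which has been asked already.
  refine WP.seq (((WP.block (by simp [Prog.LoopFree]) ?_).frame (SN := ∅) (SR := {42})
    (Q := fun s' => s'.real 42 0 = (I.L - (O.final I.Below).c) / (O.final I.Below).s)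
    (by simp [Prog.WritesIn])).mono (by simp [Prog.cost, NExpr.cost, RExpr.cost]) ?_)
  · have h1 := hσ.c
    have h2 := hσ.slope
    simp only [Nat.reduceAdd] at h1 h2
    simp [Prog.exec, NExpr.eval, RExpr.eval, State.real_writeReal, hs3.len, h1, h2]
  rintro s4 ⟨hlast, hA4⟩
  have hs4 := hs3.congr hA4 (by simp) (by simp)
  have hJ4 : Search I S s4 := hJ3.congr (hA4.1 _ (by simp)) (hA4.2 _ (by simp))
  refine (hc.run 0 S s4 hs4 hJ4).mono le_rfl ?_
  rintro s5 ⟨hs5, hJ5, -⟩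
  simp only [Nat.reduceAdd, hlast] at hJ5
  have key : ∀ {mu : ℝ}, 0 ≤ mu → I.Feasible mu → _ := fun {mu} =>
    O.exists_query_le hJ5.1 (Or.inr (h0S (by simp)))
      (fun t ht => (hask t ht).trans (Set.subset_insert _ _)) (Set.mem_insert _ _) (mu := mu)
  -- Some query must be feasible, because some parameter is.
  rcases hJ5.2 with ⟨-, h⟩ | ⟨-, h1, h2, h3⟩
  · obtain ⟨mu, hmu0, hmu⟩ := I.exists_feasible
    obtain ⟨q, hq, hq0, hqf, -⟩ := key hmu0 hmu
    exact absurd ⟨hq0, hqf⟩ (h q hq)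
  · refine ⟨hs5, h1, h2, fun mu hmu0 hmu => ?_⟩
    obtain ⟨q, hq, hq0, hqf, hle⟩ := key hmu0 hmu
    exact (h3 q hq hq0 hqf).trans hle

/-- Compute the destinations for the optimum. -/
def outputProg : Prog :=
  .seq (.setReal 4 (.const 0) (.var 5))
    (.seq decideProg
      (.forLoop 12 (.var 0) (.setReal 3 (.var 12)
        (.add (.get 23 (.var 12)) (.mul (.get 24 (.var 12)) (.var 4))))))

/-- A bound for the running time of `outputProg`. -/
def outputCost (n h : ℕ) : ℕ := 4 + (decideCost n h + (n + 1) * (13 + 2 + 9))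

/-- The greedy algorithm runs once more with the optimum as parameter. The symbolic run does not
serve here: its oracle treats the optimum itself as lying above the parameter. -/
theorem outputProg_spec {O : Ranking I} {s : State} (hs : Shared O s) {lam : ℝ}
    (h5 : s.real 5 0 = lam) (hlam : 0 ≤ lam) :
    WP outputProg (outputCost n (Nat.clog 2 n))
      (fun s' => readOutput n s' = (O.final (· ≤ lam)).pos lam) s := by
  refine WP.seq (((WP.block (by simp [Prog.LoopFree]) ?_).frame (SN := ∅) (SR := {4})
    (Q := fun s' => s'.real 4 0 = lam) (by simp [Prog.WritesIn])).mono
    (by simp [Prog.cost, NExpr.cost, RExpr.cost]) ?_)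
  · simp [Prog.exec, NExpr.eval, RExpr.eval, State.real_writeReal, h5]
  rintro s1 ⟨h4, hA1⟩
  have hs1 := hs.congr hA1 (by simp) (by simp)
  refine WP.seq ((decideProg_spec hlam hs1 h4).mono le_rfl ?_)
  rintro s2 ⟨⟨hs2, hσ, -⟩, hA2⟩
  have h4' : s2.real 4 0 = lam := by rw [hA2.2 _ (by simp [Own])]; exact h4
  refine (WP.forLoop (n := n) (B := 13) (fun i s' => Agree {12} {3} s2 s' ∧
    ∀ q : Fin n, q.val < i → s'.real 3 q = (O.final (· ≤ lam)).pos lam q) ?_ ?_ ?_).mono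
    (by simp [NExpr.cost]) ?_
  · rintro i s' ⟨hA, -⟩
    have := hs2.congr hA (by simp) (by simp)
    simp [NExpr.eval, this.size]
  · exact ⟨⟨fun a ha => State.nat_writeNat_of_ne (by simpa using ha) _ _ _, fun _ _ => rfl⟩,
      by simp⟩
  · rintro i s' hi ⟨hA, h⟩ hv
    refine (WP.block (by simp [Prog.LoopFree]) ?_).mono
      (by simp [Prog.cost, NExpr.cost, RExpr.cost]) fun _ h => h
    simp only [Prog.exec, NExpr.eval, RExpr.eval, hv, State.nat_writeReal]
    refine ⟨trivial, ⟨fun a ha => ?_, fun a ha => ?_⟩, fun q hq => ?_⟩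
    · rw [State.nat_writeNat_of_ne (by simpa using ha)]
      exact hA.1 a ha
    · rw [State.real_writeNat, State.real_writeReal_of_ne (by simpa using ha)]
      exact hA.2 a ha
    · by_cases hqi : q.val = i
      · have h1 := hσ.yc q
        have h2 := hσ.ys q
        simp only [Nat.reduceAdd] at h1 h2
        rw [← hA.2 23 (by simp), hqi] at h1
        rw [← hA.2 24 (by simp), hqi] at h2
        rw [← hA.2 4 (by simp)] at h4'
        simp [State.real_writeNat, State.real_writeReal, hqi, h1, h2, h4', Conf.pos]
      · simpa [State.real_writeNat, State.real_writeReal, hqi] using h q (by omega)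
  · rintro s' ⟨-, h⟩
    funext q
    exact h q q.isLt

/-- The greedy positions move no sensor by more than `lam`, and every coverage witnesses that its
own maximum move is feasible. -/
theorem optimal_of_final {O : Ranking I} {lam : ℝ} (hlam : 0 ≤ lam) (hf : I.Feasible lam)
    (hmin : ∀ mu, 0 ≤ mu → I.Feasible mu → lam ≤ mu) :
    I.IsOptimal ((O.final (· ≤ lam)).pos lam) := by
  have : Nonempty (Fin n) := ⟨⟨0, I.pos⟩⟩
  refine ⟨O.covers_of_final hlam ((O.le_final_iff hlam).2 hf), fun y' hy' => ?_⟩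
  have hle : ∀ i, |I.x i - y' i| ≤ I.maxMove y' := fun i =>
    le_ciSup (f := fun i => |I.x i - y' i|) (Set.finite_range _).bddAbove i
  exact (ciSup_le (O.final_good hlam).move).trans
    (hmin _ ((abs_nonneg _).trans (hle ⟨0, I.pos⟩)) ⟨y', hy', hle⟩)

end Optimize

end BCLS

/-! ### Preprocessing: rankings, number of leaves, and the complete program. -/

namespace BCLS

open RealRAM

section Rank

variable {n : ℕ}

/-- The order by `f`, ties broken by index. -/
def Precedes (f : Fin n → ℝ) (j i : Fin n) : Prop := f j < f i ∨ (f j ≤ f i ∧ j < i)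

open Classical in
/-- The number of predecessors of `i`. -/
noncomputable def rankOf (f : Fin n → ℝ) (i : Fin n) : ℕ :=
  (Finset.univ.filter fun j => Precedes f j i).card

/-- By transitivity the predecessors of `j` precede `i`, and `j` itself is an additional one. -/
theorem rankOf_lt_rankOf {f : Fin n → ℝ} {i j : Fin n} (h : Precedes f j i) :
    rankOf f j < rankOf f i := by
  classical
  refine Finset.card_lt_card (Finset.ssubset_iff_subset_ne.2 ⟨fun q hq => ?_, fun heq => ?_⟩)
  · refine Finset.mem_filter.2 ⟨Finset.mem_univ q, ?_⟩
    rcases (Finset.mem_filter.1 hq).2 with h1 | ⟨h1, h2⟩ <;> rcases h with h3 | ⟨h3, h4⟩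
    · exact Or.inl (h1.trans h3)
    · exact Or.inl (h1.trans_le h3)
    · exact Or.inl (h1.trans_lt h3)
    · exact Or.inr ⟨h1.trans h3, h2.trans h4⟩
  · have : j ∈ Finset.univ.filter fun q => Precedes f q j := by
      rw [heq]; simpa using h
    exact absurd (Finset.mem_filter.1 this).2 (by simp [Precedes])

theorem precedes_total (f : Fin n → ℝ) {i j : Fin n} (h : i ≠ j) :
    Precedes f i j ∨ Precedes f j i := by
  rcases lt_trichotomy (f i) (f j) with h1 | h1 | h1
  · exact Or.inl (Or.inl h1)
  · rcases lt_or_gt_of_ne h with h2 | h2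
    · exact Or.inl (Or.inr ⟨h1.le, h2⟩)
    · exact Or.inr (Or.inr ⟨h1.ge, h2⟩)
  · exact Or.inr (Or.inl h1)

theorem rankOf_injective (f : Fin n → ℝ) : Function.Injective (rankOf f) := by
  intro i j h
  by_contra hij
  rcases precedes_total f hij with h' | h' <;> have := rankOf_lt_rankOf h' <;> omega

theorem rankOf_lt (f : Fin n → ℝ) (i : Fin n) : rankOf f i < n := by
  classical
  have : (Finset.univ.filter fun j => Precedes f j i).card < (Finset.univ : Finset (Fin n)).card :=
    Finset.card_lt_card (Finset.filter_ssubset.2 ⟨i, Finset.mem_univ i, by simp [Precedes]⟩)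
  simpa [rankOf] using this

/-- The ranking by `f`. -/
noncomputable def rankPerm (f : Fin n → ℝ) : Equiv.Perm (Fin n) :=
  Equiv.ofBijective (fun i => ⟨rankOf f i, rankOf_lt f i⟩)
    (Finite.injective_iff_bijective.1 fun _ _ h => rankOf_injective f (Fin.ext_iff.1 h))

theorem rankPerm_val (f : Fin n → ℝ) (i : Fin n) : (rankPerm f i).val = rankOf f i := rfl

theorem le_of_rankPerm_le {f : Fin n → ℝ} {i j : Fin n} (h : rankPerm f i ≤ rankPerm f j) :
    f i ≤ f j := by
  by_contra hcon
  have h1 := rankOf_lt_rankOf (f := f) (Or.inl (not_le.1 hcon))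
  rw [Fin.le_def, rankPerm_val, rankPerm_val] at h
  omega

/-- The rankings by deadline and by release. -/
noncomputable def Input.ranking (I : Input n) : Ranking I where
  rb := rankPerm fun i => I.x i + I.r i
  ra := rankPerm fun i => I.x i - I.r i
  deadline_mono _ _ h := le_of_rankPerm_le (f := fun i => I.x i + I.r i) h
  release_mono _ _ h := le_of_rankPerm_le (f := fun i => I.x i - I.r i) h

/-- Increase the counter if sensor `j` precedes sensor `i`. -/
def countProg (key : NExpr → RExpr) : Prog :=
  .cond (.realLt (key (.var 14)) (key (.var 13)))
    (.setNat 15 (.const 0) (.add (.var 15) (.const 1)))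
    (.cond (.realLe (key (.var 14)) (key (.var 13)))
      (.cond (.natLt (.var 14) (.var 13))
        (.setNat 15 (.const 0) (.add (.var 15) (.const 1))) .skip) .skip)

/-- Compute the rank of each sensor, and store the ranking in array `b` and its inverse in
array `a`. -/
def rankProg (key : NExpr → RExpr) (a b : ℕ) : Prog :=
  .forLoop 13 (.var 0) (.seq (.setNat 15 (.const 0) (.const 0))
    (.seq (.forLoop 14 (.var 0) (countProg key))
      (.seq (.setNat a (.var 15) (.var 13)) (.setNat b (.var 13) (.var 15)))))

/-- A bound for the running time of `rankProg`. -/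
def rankCost (key : NExpr → RExpr) (n : ℕ) : ℕ :=
  (n + 1) * (3 + ((n + 1) * ((countProg key).cost + 2 + 9) + 10) + 2 + 9)

/-- Ranks are found by counting predecessors. This quadratic method fits into the time bound, so no
sorting algorithm is needed. Only naturals are written, hence `hkey` may assume unchanged reals. -/
theorem rankProg_spec {f : Fin n → ℝ} {key : NExpr → RExpr} {a b : ℕ} {s : State}
    (hab : a ≠ b) (ha0 : a ≠ 0) (hb0 : b ≠ 0) (ha : a < 10) (hb : b < 10)
    (hn : s.nat 0 0 = n)
    (hkey : ∀ (s' : State) (e : NExpr) (i : Fin n), s'.real = s.real → e.eval s' = i →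
      (key e).eval s' = f i) :
    WP (rankProg key a b) (rankCost key n) (fun s' => (∀ i : Fin n,
      s'.nat a (rankPerm f i) = i ∧ s'.nat b i = rankPerm f i) ∧
      Agree {13, 14, 15, a, b} ∅ s s') s := by
  classical
  refine WP.frame ?_ (by
    simp [rankProg, countProg, Prog.forLoop, Prog.WritesIn])
  refine (WP.forLoop (n := n) (B := 3 + ((n + 1) * ((countProg key).cost + 2 + 9) + 10))
    (fun i s' => Agree {13, 14, 15, a, b} ∅ s s' ∧ ∀ q : Fin n, q.val < i →
      s'.nat a (rankPerm f q) = q ∧ s'.nat b q = rankPerm f q) ?_ ?_ ?_).mono ?_ ?_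
  · rintro i s' ⟨hA, -⟩
    simp [NExpr.eval, hA.1 0 (by simp [ha0.symm, hb0.symm]), hn]
  · refine ⟨⟨fun c hc => State.nat_writeNat_of_ne (by simp at hc; tauto) _ _ _, fun _ _ => rfl⟩,
      by simp⟩
  · rintro i s' hi ⟨hA, hq⟩ hv
    refine WP.seq (((WP.block (by simp [Prog.LoopFree]) ?_).frame (SN := {15}) (SR := ∅)
      (Q := fun s' => s'.nat 15 0 = 0) (by simp [Prog.WritesIn])).mono
      (by simp [Prog.cost, NExpr.cost]) ?_)
    · simp [Prog.exec, NExpr.eval, State.nat_writeNat]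
    rintro s1 ⟨h15, hA1⟩
    have hA1' : Agree {13, 14, 15, a, b} ∅ s s1 := hA.trans (hA1.mono (by simp) subset_rfl)
    have hv1 : s1.nat 13 0 = i := by rw [hA1.1 13 (by simp)]; exact hv
    refine WP.seq (((WP.forLoop (n := n) (B := (countProg key).cost) (fun j s2 =>
      Agree {14, 15} ∅ s1 s2 ∧ s2.nat 15 0 = (Finset.univ.filter fun q : Fin n =>
        q.val < j ∧ Precedes f q ⟨i, hi⟩).card) ?_ ?_ ?_)).mono (by simp [NExpr.cost]) ?_)
    · rintro j s2 ⟨hA2, -⟩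
      simp [NExpr.eval, hA2.1 0 (by simp), hA1'.1 0 (by simp [ha0.symm, hb0.symm]), hn]
    · refine ⟨⟨fun c hc => State.nat_writeNat_of_ne (by simp at hc; tauto) _ _ _,
        fun _ _ => rfl⟩, by simp [State.nat_writeNat, h15]⟩
    · rintro j s2 hj ⟨hA2, h2⟩ hv2
      have hreal : s2.real = s.real :=
        funext fun c => (hA2.2 c (by simp)).trans (hA1'.2 c (by simp))
      have hv13 : s2.nat 13 0 = i := by rw [hA2.1 13 (by simp)]; exact hv1
      have hki := hkey s2 (.var 13) ⟨i, hi⟩ hreal (by simpa [NExpr.eval] using hv13)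
      have hkj := hkey s2 (.var 14) ⟨j, hj⟩ hreal (by simpa [NExpr.eval] using hv2)
      have hsucc : (Finset.univ.filter fun q : Fin n =>
          q.val < j + 1 ∧ Precedes f q ⟨i, hi⟩).card =
          (Finset.univ.filter fun q : Fin n => q.val < j ∧ Precedes f q ⟨i, hi⟩).card +
            if Precedes f ⟨j, hj⟩ ⟨i, hi⟩ then 1 else 0 := by
        by_cases hp : Precedes f ⟨j, hj⟩ ⟨i, hi⟩
        · rw [if_pos hp, ← Finset.card_insert_of_notMem (a := ⟨j, hj⟩) (by simp)]
          congr 1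
          ext q
          simp only [Finset.mem_filter, Finset.mem_univ, true_and, Finset.mem_insert]
          constructor
          · rintro ⟨h1, h2⟩
            by_cases hqj : q.val = j
            · exact Or.inl (Fin.ext hqj)
            · exact Or.inr ⟨by omega, h2⟩
          · rintro (rfl | ⟨h1, h2⟩)
            · exact ⟨by simp, hp⟩
            · exact ⟨by omega, h2⟩
        · rw [if_neg hp, add_zero]
          congr 1
          ext q
          simp only [Finset.mem_filter, Finset.mem_univ, true_and]
          refine and_congr_left fun h => ⟨fun h1 => ?_, fun h1 => by omega⟩
          by_contra hcon
          have : q = ⟨j, hj⟩ := Fin.ext (by simp; omega)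
          exact hp (this ▸ h)
      refine ((WP.block (Q := fun s3 => s3.nat 15 0 = s2.nat 15 0 +
          if Precedes f ⟨j, hj⟩ ⟨i, hi⟩ then 1 else 0) (by simp [countProg, Prog.LoopFree])
          ?_).frame (SN := {15}) (SR := ∅) (by simp [countProg, Prog.WritesIn])).mono le_rfl ?_
      · by_cases c1 : f ⟨j, hj⟩ < f ⟨i, hi⟩
        · simp [countProg, Prog.exec, Test.Holds, hki, hkj, Precedes, c1, NExpr.eval,
            State.nat_writeNat]
        · by_cases c2 : f ⟨j, hj⟩ ≤ f ⟨i, hi⟩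
          · by_cases c3 : j < i <;>
              simp [countProg, Prog.exec, Test.Holds, hki, hkj, Precedes, c1, c2, c3, NExpr.eval,
                State.nat_writeNat, hv13, hv2]
          · simp [countProg, Prog.exec, Test.Holds, hki, hkj, Precedes, c1, c2]
      · rintro s3 ⟨h3, hA3⟩
        refine ⟨by rw [hA3.1 14 (by simp)]; exact hv2, ⟨fun c hc => ?_, fun c hc => ?_⟩, ?_⟩
        · simp at hc
          rw [State.nat_writeNat_of_ne hc.1, hA3.1 c (by simp [hc]), hA2.1 c (by simp [hc])]
        · rw [State.real_writeNat, hA3.2 c hc, hA2.2 c hc]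
        · rw [State.nat_writeNat_of_ne (by norm_num), h3, h2, hsucc]
    rintro s2 ⟨hA2, h2⟩
    have hv13 : s2.nat 13 0 = i := by rw [hA2.1 13 (by simp)]; exact hv1
    have hrank : s2.nat 15 0 = rankPerm f ⟨i, hi⟩ := by
      rw [h2, rankPerm_val, rankOf]
      simp
    refine (WP.block (by simp [Prog.LoopFree]) ?_).mono (by simp [Prog.cost, NExpr.cost])
      fun _ h => h
    have n13a : (13 : ℕ) ≠ a := by omega
    have n15a : (15 : ℕ) ≠ a := by omega
    have n13b : (13 : ℕ) ≠ b := by omega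
    have na13 : a ≠ 13 := by omega
    have nb13 : b ≠ 13 := by omega
    simp only [Prog.exec, NExpr.eval, State.nat_writeNat, n13a, n15a, n13b, false_and, if_false,
      hv13, hrank]
    refine ⟨trivial, ⟨fun c hc => ?_, fun c hc => ?_⟩, fun q hq' => ?_⟩
    · simp at hc
      rw [State.nat_writeNat_of_ne hc.1, State.nat_writeNat_of_ne hc.2.2.2.2,
        State.nat_writeNat_of_ne hc.2.2.2.1, hA2.1 c (by simp [hc]), hA1'.1 c (by simp [hc])]
    · rw [State.real_writeNat, State.real_writeNat, State.real_writeNat, hA2.2 c (by simp),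
        hA1'.2 c hc]
    · have ha2 : s2.nat a = s'.nat a := by
        rw [hA2.1 a (by simp; omega), hA1.1 a (by simp; omega)]
      have hb2 : s2.nat b = s'.nat b := by
        rw [hA2.1 b (by simp; omega), hA1.1 b (by simp; omega)]
      simp only [na13, nb13, hab, hab.symm, false_and, if_false, true_and]
      by_cases hqi : q = ⟨i, hi⟩
      · subst hqi
        simp
      · have h1 : (rankPerm f q).val ≠ (rankPerm f ⟨i, hi⟩).val := fun h =>
          hqi ((rankPerm f).injective (Fin.ext h))
        have h2 : q.val ≠ i := fun h => hqi (Fin.ext h)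
        rw [if_neg h1, if_neg h2, ha2, hb2]
        exact hq q (by omega)
  · exact le_of_eq (by simp [rankCost, NExpr.cost])
  · rintro s' ⟨-, h⟩ i
    exact h i i.isLt

/-- Compute the number of leaves of the trees. -/
def leavesProg : Prog :=
  .seq (.setNat 4 (.const 0) (.const 1))
    (.loop (.natLt (.var 4) (.var 0)) (.setNat 4 (.const 0) (.add (.var 4) (.var 4))))

theorem leavesProg_spec {s : State} (hn : s.nat 0 0 = n) :
    WP leavesProg (3 + (Nat.clog 2 n * (5 + 7) + 5))
      (fun s' => s'.nat 4 0 = 2 ^ Nat.clog 2 n ∧ Agree {4} ∅ s s') s := by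
  refine WP.frame ?_ (by simp [leavesProg, Prog.WritesIn])
  refine WP.seq ((WP.block (by simp [Prog.LoopFree]) ?_).mono (by simp [Prog.cost, NExpr.cost])
    fun _ h => h)
  refine (WP.loop (B := 7) (fun k s' => s'.nat 0 0 = n ∧
    ∃ l, s'.nat 4 0 = 2 ^ l ∧ l + k = Nat.clog 2 n) ?_ ?_ (k := Nat.clog 2 n) ?_).mono
    (by simp [Test.cost, NExpr.cost]) ?_
  · rintro s' ⟨h0, l, h1, h2⟩ hb
    simp only [Test.Holds, NExpr.eval, h0, h1] at hb
    have := Nat.le_pow_clog (b := 2) (by norm_num) n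
    rw [← h2, add_zero] at this
    omega
  · rintro k s' ⟨h0, l, h1, h2⟩ -
    refine (WP.block (by simp [Prog.LoopFree]) ?_).mono (by simp [Prog.cost, NExpr.cost])
      fun _ h => h
    refine ⟨by simpa [Prog.exec, State.nat_writeNat] using h0, l + 1, ?_, by omega⟩
    simp [Prog.exec, NExpr.eval, State.nat_writeNat, h1]
    ring
  · exact ⟨by simpa [Prog.exec, State.nat_writeNat] using hn, 0,
      by simp [Prog.exec, NExpr.eval, State.nat_writeNat], by simp⟩
  · rintro s' ⟨⟨k, h0, l, h1, h2⟩, hb⟩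
    simp only [Test.Holds, NExpr.eval, h0, h1, not_lt] at hb
    have := Nat.clog_le_of_le_pow hb
    have : l = Nat.clog 2 n := by omega
    rw [h1, this]

/-- The right end of the range of a sensor. -/
def deadlineKey (e : NExpr) : RExpr := .add (.get 1 e) (.get 2 e)

/-- The left end of the range of a sensor. -/
def releaseKey (e : NExpr) : RExpr := .sub (.get 1 e) (.get 2 e)

/-- Compute the tables. -/
def tablesProg : Prog :=
  .seq (rankProg deadlineKey 1 3) (.seq (rankProg releaseKey 2 5) leavesProg)

/-- A bound for the running time of `tablesProg`. -/
def tablesCost (n h : ℕ) : ℕ :=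
  rankCost deadlineKey n + (rankCost releaseKey n + (3 + (h * (5 + 7) + 5)))

theorem tablesProg_spec (I : Input n) :
    WP tablesProg (tablesCost n (Nat.clog 2 n)) (Shared I.ranking) I.load := by
  have hx : ∀ i : Fin n, I.load.real 1 i = I.x i := by intro i; simp [Input.load]
  have hr : ∀ i : Fin n, I.load.real 2 i = I.r i := by intro i; simp [Input.load]
  have hL : I.load.real 0 0 = I.L := by simp [Input.load]
  have hn : I.load.nat 0 0 = n := by simp [Input.load]
  refine WP.seq ((rankProg_spec (f := fun i => I.x i + I.r i) (by norm_num) (by norm_num)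
    (by norm_num) (by norm_num) (by norm_num) hn ?_).mono le_rfl ?_)
  · intro s' e i h he
    simp [deadlineKey, RExpr.eval, he, h, hx, hr]
  rintro s1 ⟨h1, hA1⟩
  have e1 : s1.real = I.load.real := funext fun c => hA1.2 c (by simp)
  refine WP.seq ((rankProg_spec (f := fun i => I.x i - I.r i) (by norm_num) (by norm_num)
    (by norm_num) (by norm_num) (by norm_num)
    (by rw [hA1.1 0 (by simp)]; exact hn) ?_).mono le_rfl ?_)
  · intro s' e i h he
    simp [releaseKey, RExpr.eval, he, h, e1, hx, hr]
  rintro s2 ⟨h2, hA2⟩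
  have e2 : s2.real = I.load.real := (funext fun c => hA2.2 c (by simp)).trans e1
  have hn2 : s2.nat 0 0 = n := by rw [hA2.1 0 (by simp), hA1.1 0 (by simp)]; exact hn
  refine (leavesProg_spec hn2).mono le_rfl ?_
  rintro s3 ⟨h3, hA3⟩
  have e3 : s3.real = I.load.real := (funext fun c => hA3.2 c (by simp)).trans e2
  refine ⟨?_, ?_, ?_, ?_, ?_, ?_, ?_, h3⟩
  · rw [hA3.1 0 (by simp)]; exact hn2
  · rw [e3]; exact hL
  · rw [e3]; exact hx
  · rw [e3]; exact hr
  · intro i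
    rw [hA3.1 1 (by simp), hA2.1 1 (by simp)]
    exact (h1 i).1
  · intro i
    rw [hA3.1 2 (by simp)]
    exact (h2 i).1
  · intro i
    rw [hA3.1 3 (by simp), hA2.1 3 (by simp)]
    exact (h1 i).2

/-- The algorithm. -/
def coverageProg : Prog := .seq tablesProg (.seq searchProg outputProg)

/-- A bound for the running time of the algorithm. -/
def coverageCost (n : ℕ) : ℕ :=
  tablesCost n (Nat.clog 2 n) + (searchCost n (Nat.clog 2 n) + outputCost n (Nat.clog 2 n))

theorem coverageProg_solves : SolvesWithin coverageProg coverageCost := by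
  intro n I
  refine WP.seq ((tablesProg_spec I).mono le_rfl fun s1 hs1 => ?_)
  refine WP.seq ((searchProg_spec hs1).mono le_rfl ?_)
  rintro s2 ⟨hs2, h0, hf, hmin⟩
  refine (outputProg_spec hs2 rfl h0).mono le_rfl fun s3 h3 => ?_
  rw [h3]
  exact optimal_of_final h0 hf hmin

end Rank

/-! ### The running time is O(n² log n). -/

section Cost

theorem two_pow_clog_le (n : ℕ) : 2 ^ Nat.clog 2 n ≤ 2 * n + 1 := by
  rcases Nat.lt_or_ge 1 n with h | h
  · have h1 := Nat.pow_pred_clog_lt_self (b := 2) (by norm_num) h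
    have h2 : 0 < Nat.clog 2 n := Nat.clog_pos (by norm_num) h
    have : 2 ^ Nat.clog 2 n = 2 ^ (Nat.clog 2 n).pred * 2 := by
      rw [← Nat.pow_succ, Nat.succ_pred_eq_of_pos h2]
    omega
  · interval_cases n <;> simp

theorem exists_stepCost_le (m : ℕ) : ∃ A, ∀ B h, stepCost m B h ≤ A * (h + 1) + 3 * B := by
  -- The constants are found by unification with the definition; only linearity in the height
  -- matters.
  obtain ⟨a, b, h1⟩ : ∃ a b, ∀ h,
      climbCost (m + 20) (m + 23) (fun e => .add e (.const 1)) h = h * a + b :=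
    ⟨_, _, fun _ => rfl⟩
  obtain ⟨c, d, h2⟩ : ∃ a b, ∀ h,
      climbCost (m + 20) (m + 23) (fun e => .sub e (.const 1)) h = h * a + b :=
    ⟨_, _, fun _ => rfl⟩
  refine ⟨100 + a + b + c + d + (thresholdProg m).cost + (slopeProg m).cost + (assignProg m).cost,
    fun B h => ?_⟩
  simp only [stepCost, actCost, descendCost, h1, h2]
  generalize (thresholdProg m).cost = e1
  generalize (slopeProg m).cost = e2
  generalize (assignProg m).cost = e3
  have := Nat.zero_le (h * b)
  have := Nat.zero_le (h * d)
  have := Nat.zero_le (h * e1)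
  have := Nat.zero_le (h * e2)
  have := Nat.zero_le (h * e3)
  nlinarith

/-- There are `2 * n` steps with three queries each, which gives the term `6 * (n + 1) * B`. All
else costs a logarithmic amount per step. -/
theorem exists_greedyCost_le (m : ℕ) : ∃ A, ∀ B n,
    greedyCost m B n (Nat.clog 2 n) ≤ A * ((n + 1) * (Nat.clog 2 n + 1)) + 6 * (n + 1) * B := by
  obtain ⟨A, hA⟩ := exists_stepCost_le m
  refine ⟨2 * A + 200, fun B n => ?_⟩
  have h1 := hA B (Nat.clog 2 n)
  have h2 := two_pow_clog_le n
  simp only [greedyCost, startCost]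
  generalize stepCost m B (Nat.clog 2 n) = t at h1
  generalize 2 ^ Nat.clog 2 n = u at h2
  generalize Nat.clog 2 n = h at h1
  have h3 : (2 * n + 1) * (t + 5 + 9) ≤ (2 * n + 2) * (A * (h + 1) + 3 * B + 14) :=
    Nat.mul_le_mul (by omega) (by omega)
  have h4 : n + 1 ≤ (n + 1) * (h + 1) := Nat.le_mul_of_pos_right _ (by omega)
  nlinarith

theorem exists_decideCost_le : ∃ A, ∀ n,
    decideCost n (Nat.clog 2 n) ≤ A * ((n + 1) * (Nat.clog 2 n + 1)) := by
  obtain ⟨A, hA⟩ := exists_greedyCost_le 0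
  refine ⟨A + 100, fun n => ?_⟩
  have h1 := hA 11 n
  simp only [decideCost]
  have h4 : n + 1 ≤ (n + 1) * (Nat.clog 2 n + 1) := Nat.le_mul_of_pos_right _ (by omega)
  nlinarith

theorem exists_coverageCost_le : ∃ A, ∀ n,
    coverageCost n ≤ A * ((n + 1) ^ 2 * (Nat.clog 2 n + 1)) := by
  obtain ⟨D, hD⟩ := exists_decideCost_le
  obtain ⟨G, hG⟩ := exists_greedyCost_le 20
  obtain ⟨a, b, h1⟩ : ∃ a b, ∀ n, rankCost deadlineKey n = (n + 1) * (3 + ((n + 1) * a + b) + 2 + 9) :=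
    ⟨_, _, fun _ => rfl⟩
  obtain ⟨a', b', h1'⟩ : ∃ a b, ∀ n, rankCost releaseKey n = (n + 1) * (3 + ((n + 1) * a + b) + 2 + 9) :=
    ⟨_, _, fun _ => rfl⟩
  -- The factor 9 counts the oracle cost: 6 in the symbolic run, 2 for the separate queries, and 1
  -- to bound the final decision. The overhead of an oracle call over a decision is `46 = 3 + 4 + 4
  -- + 35`.
  refine ⟨a + b + a' + b' + G + 9 * (D + 46) + 200, fun n => ?_⟩
  have hd := hD n
  have hg := hG (oracleCost n (Nat.clog 2 n)) n
  have ho : oracleCost n (Nat.clog 2 n) = decideCost n (Nat.clog 2 n) + 46 := by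
    simp only [oracleCost]; ring
  simp only [coverageCost, tablesCost, searchCost, outputCost, h1, h1']
  generalize greedyCost 20 (oracleCost n (Nat.clog 2 n)) n (Nat.clog 2 n) = g at hg
  generalize oracleCost n (Nat.clog 2 n) = o at hg ho
  generalize decideCost n (Nat.clog 2 n) = d at hd ho
  generalize Nat.clog 2 n = h at *
  set M := n + 1 with hM
  have k1 : 1 ≤ M := by omega
  have k2 : M * (h + 1) ≤ M ^ 2 * (h + 1) := Nat.mul_le_mul_right _ (by nlinarith)
  have k3 : M ^ 2 ≤ M ^ 2 * (h + 1) := Nat.le_mul_of_pos_right _ (by omega)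
  have k4 : M ≤ M ^ 2 := by nlinarith
  have k5 : h + 1 ≤ M ^ 2 * (h + 1) := Nat.le_mul_of_pos_left _ (by positivity)
  have k6 : 1 ≤ M * (h + 1) := Nat.mul_pos k1 (by omega)
  have ho' : o ≤ (D + 46) * (M * (h + 1)) := by nlinarith
  have ho2 : M * o ≤ (D + 46) * (M ^ 2 * (h + 1)) := by
    calc M * o ≤ M * ((D + 46) * (M * (h + 1))) := Nat.mul_le_mul_left _ ho'
      _ = _ := by ring
  have ho3 : o ≤ (D + 46) * (M ^ 2 * (h + 1)) := ho'.trans (Nat.mul_le_mul_left _ k2)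
  have hg' : g ≤ G * (M ^ 2 * (h + 1)) + 6 * ((D + 46) * (M ^ 2 * (h + 1))) := by
    have := Nat.mul_le_mul_left G k2
    nlinarith
  set W := M ^ 2 * (h + 1) with hW
  have r1 : M * (3 + (M * a + b) + 2 + 9) ≤ (a + b + 14) * W := by
    have e : M * (3 + (M * a + b) + 2 + 9) = M ^ 2 * a + M * (b + 14) := by ring
    have := Nat.mul_le_mul_right a k3
    have := Nat.mul_le_mul_right (b + 14) (k4.trans k3)
    rw [e]
    nlinarith
  have r2 : M * (3 + (M * a' + b') + 2 + 9) ≤ (a' + b' + 14) * W := by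
    have e : M * (3 + (M * a' + b') + 2 + 9) = M ^ 2 * a' + M * (b' + 14) := by ring
    have := Nat.mul_le_mul_right a' k3
    have := Nat.mul_le_mul_right (b' + 14) (k4.trans k3)
    rw [e]
    nlinarith
  have hMW : M ≤ W := k4.trans k3
  have hDW : d ≤ (D + 46) * W := by omega
  nlinarith

/-- The predecessor of the ceiling logarithm is at most `log n / log 2`, and the remaining 2 is
absorbed because this quotient is at least 1. -/
theorem clog_add_one_le {n : ℕ} (hn : 2 ≤ n) :
    ((Nat.clog 2 n + 1 : ℕ) : ℝ) ≤ 3 / Real.log 2 * Real.log n := by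
  have hl2 : 0 < Real.log 2 := Real.log_pos (by norm_num)
  have h1 : 2 ^ (Nat.clog 2 n).pred ≤ n :=
    (Nat.pow_pred_clog_lt_self (b := 2) (by norm_num) hn).le
  have h2 : 0 < Nat.clog 2 n := Nat.clog_pos (by norm_num) hn
  have h3 : ((Nat.clog 2 n).pred : ℝ) * Real.log 2 ≤ Real.log n := by
    rw [← Real.log_pow]
    exact Real.log_le_log (by positivity) (by exact_mod_cast h1)
  have h4 : Real.log 2 ≤ Real.log n :=
    Real.log_le_log (by norm_num) (by exact_mod_cast hn)
  have h5 : ((Nat.clog 2 n + 1 : ℕ) : ℝ) = ((Nat.clog 2 n).pred : ℝ) + 2 := by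
    have : Nat.clog 2 n + 1 = (Nat.clog 2 n).pred + 2 := by
      have := Nat.succ_pred_eq_of_pos h2
      omega
    rw [this]
    push_cast
    ring
  rw [h5, div_mul_eq_mul_div, le_div_iff₀ hl2]
  linarith

theorem coverageCost_isBigO : (fun n : ℕ => (coverageCost n : ℝ)) =O[Filter.atTop]
    fun n : ℕ => (n : ℝ) ^ 2 * Real.log (n : ℝ) := by
  obtain ⟨A, hA⟩ := exists_coverageCost_le
  refine Asymptotics.IsBigO.of_bound (A * (4 * (3 / Real.log 2))) ?_
  filter_upwards [Filter.eventually_ge_atTop 2] with n hn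
  have hn' : (2 : ℝ) ≤ n := by exact_mod_cast hn
  have hlog : 0 ≤ Real.log n := Real.log_nonneg (by linarith)
  rw [Real.norm_of_nonneg (by positivity), Real.norm_of_nonneg (by positivity)]
  have h1 : (coverageCost n : ℝ) ≤ A * (((n : ℝ) + 1) ^ 2 * ((Nat.clog 2 n + 1 : ℕ) : ℝ)) := by
    exact_mod_cast hA n
  have h2 : ((n : ℝ) + 1) ^ 2 ≤ 4 * (n : ℝ) ^ 2 := by nlinarith
  calc (coverageCost n : ℝ) ≤ A * (((n : ℝ) + 1) ^ 2 * ((Nat.clog 2 n + 1 : ℕ) : ℝ)) := h1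
    _ ≤ A * (4 * (n : ℝ) ^ 2 * (3 / Real.log 2 * Real.log n)) := by
      gcongr
      exact clog_add_one_le hn
    _ = _ := by ring

end Cost

end BCLS

theorem theorem3 :
    ∃ (P : RealRAM.Prog) (T : ℕ → ℕ),
      BCLS.SolvesWithin P T ∧
        (fun n : ℕ => (T n : ℝ)) =O[Filter.atTop]
          (fun n : ℕ => (n : ℝ) ^ 2 * Real.log (n : ℝ)) := by
  exact ⟨_, _, BCLS.coverageProg_solves, BCLS.coverageCost_isBigO⟩
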